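/- Conventions. An algorithm is a (possibly partial) recursive function, acting on rationals, finite lists, etc. through fixed effective numberings. A \emph{computable metric space} is a metric space $(X,d)$ with a dense sequence $(s_i)_{i\in\mathbb N}$ of \emph{ideal points} whose distances $d(s_i,s_j)$ are computable reals uniformly in $i,j$ ($\mathbb R$ is one, with the rationals as ideal points). Its \emph{ideal balls} are the balls $B(s_i,q)$, $q\in\mathbb Q_{>0}$, effectively numbered. A point $x$ is \emph{computable} if some algorithm $n\mapsto i_n$ satisfies $d(s_{i_n},x)\le 2^{-n}$ for all $n$. Sets $U_0,U_1,\dots$ are \emph{uniformly constructive open} if one algorithm, given $i$, enumerates ideal balls with union $U_i$; a \emph{constructive $G_\delta$-set} is the intersection of such a sequence. A function $f:X\to Y$ between computable metric spaces is \emph{computable on} $D\subseteq X$ if there are uniformly constructive open sets $U_i$ with $f^{-1}(B^Y_i)\cap D=U_i\cap D$ for every $i$, where $(B_i^Y)$ is the numbering of the ideal balls of $Y$. A Borel probability measure $\mu$ on $X$ is \emph{computable} if there is an algorithmic sequence $(\mu_n)$ of finitely supported probability measures, with ideal points as atoms and rational weights, whose Prokhorov distance to $\mu$ satisfies $\rho(\mu_n,\mu)\le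 2^{-n}$ for all $n$. A function on $X$ is \emph{$\delta$ a.e.-computable} if it is computable on a constructive $G_\delta$-set of $\mu$-measure one. A \emph{constructive Borel--Cantelli set} is a set $\bigcup_k\bigcap_{n\ge k}U_n$, where the $U_n$ are uniformly constructive open and $\sum_n\mu(X\setminus U_n)$ converges effectively, i.e. from each rational $\epsilon>0$ one can compute $N$ with $\sum_{n\ge N}\mu(X\setminus U_n)\le\epsilon$. Statement. Let $(X,T,\mu)$ be a computable dynamical system: $X$ is a computable metric space, $\mu$ is a computable Borel probability measure on $X$, and $T:X\to X$ is a Borel, $\mu$-preserving, $\delta$ a.e.-computable map. Let $\mathcal B$ be a set of bounded Borel functions $X\to\mathbb R$ for which the system is $\ln^2$-ergodic: for all $\phi,\psi\in\mathcal B$ there is $c_{\phi,\psi}>0$ such that $$\left|\frac1n\sum_{i<n}\int\phi\circ T^i\cdot\psi\,d\mu-\int\phi\,d\mu\int\psi\,d\mu\right|\le\frac{c_{\phi,\psi}}{(\ln n)^2}\qquad\text{for all } n\ge2.$$ Let $\phi\in\mathcal B$ be $\delta$ a.e.-computable. Then the set of points typical for $\phi$, $$\Big\{x\in X:\ \lim_{n\to\infty}\frac1n\sum_{i<n}\phi(T^i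 x)=\int\phi\,d\mu\Big\},$$ contains a constructive Borel--Cantelli set. If moreover $X$ is complete, then this set contains computable points, i.e. there is a computable point that is typical for $\phi$. -/

import Mathlib

open MeasureTheory Filter Topology

/-- An effective numbering of the rational numbers: the code of `(a - b) / (c + 1)` is built from
`a`, `b`, `c` by the standard pairing function. -/
def ratOf (n : ℕ) : ℚ :=
  ((n.unpair.1 : ℚ) - (n.unpair.2.unpair.1 : ℚ)) / ((n.unpair.2.unpair.2 : ℚ) + 1)

/-- An effective numbering of the positive rational numbers. -/
def posRatOf (n : ℕ) : ℚ :=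
  ((n.unpair.1 : ℚ) + 1) / ((n.unpair.2 : ℚ) + 1)

theorem ratOf_surjective : Function.Surjective ratOf := by
  intro q
  have hd : ((q.den - 1 : ℕ) : ℚ) + 1 = q.den := by
    have := q.den_pos
    exact_mod_cast Nat.sub_add_cancel this
  have hn : ((q.num.toNat : ℕ) : ℚ) - ((-q.num).toNat : ℕ) = q.num := by
    have := Int.toNat_sub_toNat_neg q.num
    exact_mod_cast this
  refine ⟨Nat.pair q.num.toNat (Nat.pair (-q.num).toNat (q.den - 1)), ?_⟩
  simp only [ratOf, Nat.unpair_pair]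
  rw [hn, hd, Rat.num_div_den]

/-- The code of `|ratOf i - ratOf j|`. -/
def ratDistCode (i j : ℕ) : ℕ :=
  let P := i.unpair.1 * (j.unpair.2.unpair.2 + 1) + j.unpair.2.unpair.1 * (i.unpair.2.unpair.2 + 1)
  let Q := i.unpair.2.unpair.1 * (j.unpair.2.unpair.2 + 1) + j.unpair.1 * (i.unpair.2.unpair.2 + 1)
  Nat.pair ((P - Q) + (Q - P)) (Nat.pair 0
    (i.unpair.2.unpair.2 * j.unpair.2.unpair.2 + (i.unpair.2.unpair.2 + j.unpair.2.unpair.2)))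

theorem ratOf_ratDistCode (i j : ℕ) : ratOf (ratDistCode i j) = |ratOf i - ratOf j| := by
  simp only [ratOf, ratDistCode, Nat.unpair_pair]
  generalize i.unpair.1 = a
  generalize i.unpair.2.unpair.1 = b
  generalize i.unpair.2.unpair.2 = c
  generalize j.unpair.1 = a'
  generalize j.unpair.2.unpair.1 = b'
  generalize j.unpair.2.unpair.2 = c'
  have key : ∀ P Q : ℕ, (((P - Q) + (Q - P) : ℕ) : ℚ) = |(P : ℚ) - Q| := by
    intro P Q
    rcases le_total P Q with h | h
    · have h' : (P : ℚ) ≤ Q := by exact_mod_cast h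
      rw [Nat.sub_eq_zero_of_le h, zero_add, Nat.cast_sub h, abs_sub_comm,
        abs_of_nonneg (by linarith)]
    · have h' : (Q : ℚ) ≤ P := by exact_mod_cast h
      rw [Nat.sub_eq_zero_of_le h, add_zero, Nat.cast_sub h, abs_of_nonneg (by linarith)]
  have hc : (0 : ℚ) < (c : ℚ) + 1 := by positivity
  have hc' : (0 : ℚ) < (c' : ℚ) + 1 := by positivity
  have hr : ((a : ℚ) - b) / (c + 1) - ((a' : ℚ) - b') / (c' + 1)
      = (((a * (c' + 1) + b' * (c + 1) : ℕ) : ℚ) - ((b * (c' + 1) + a' * (c + 1) : ℕ) : ℚ))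
        / ((c + 1) * (c' + 1)) := by
    push_cast
    field_simp
    ring
  rw [key, hr, abs_div, abs_of_pos (mul_pos hc hc')]
  push_cast
  congr 1
  · ring
  · ring

theorem ratDistCode_primrec : Primrec₂ ratDistCode := by
  have f1 : Primrec fun n : ℕ => n.unpair.1 := Primrec.fst.comp Primrec.unpair
  have f2 : Primrec fun n : ℕ => n.unpair.2 := Primrec.snd.comp Primrec.unpair
  have a : Primrec fun p : ℕ × ℕ => p.1.unpair.1 := f1.comp Primrec.fst
  have b : Primrec fun p : ℕ × ℕ => p.1.unpair.2.unpair.1 := f1.comp (f2.comp Primrec.fst)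
  have c : Primrec fun p : ℕ × ℕ => p.1.unpair.2.unpair.2 := f2.comp (f2.comp Primrec.fst)
  have a' : Primrec fun p : ℕ × ℕ => p.2.unpair.1 := f1.comp Primrec.snd
  have b' : Primrec fun p : ℕ × ℕ => p.2.unpair.2.unpair.1 := f1.comp (f2.comp Primrec.snd)
  have c' : Primrec fun p : ℕ × ℕ => p.2.unpair.2.unpair.2 := f2.comp (f2.comp Primrec.snd)
  have s := Primrec.succ.comp c
  have s' := Primrec.succ.comp c'
  have P := Primrec.nat_add.comp (Primrec.nat_mul.comp a s') (Primrec.nat_mul.comp b' s)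
  have Q := Primrec.nat_add.comp (Primrec.nat_mul.comp b s') (Primrec.nat_mul.comp a' s)
  exact Primrec₂.natPair.comp
    (Primrec.nat_add.comp (Primrec.nat_sub.comp P Q) (Primrec.nat_sub.comp Q P))
    (Primrec₂.natPair.comp (Primrec.const 0)
      (Primrec.nat_add.comp (Primrec.nat_mul.comp c c') (Primrec.nat_add.comp c c')))

/-- A computable metric space: a metric space with a dense sequence of ideal points whose mutual
distances are uniformly computable real numbers. -/
class ComputableMetricSpace (X : Type*) [MetricSpace X] where
  /-- the ideal points -/
  ideal : ℕ → X
  dense_ideal : DenseRange ideal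
  dist_computable : ∃ A : ℕ × ℕ × ℕ → ℕ, Computable A ∧
    ∀ i j n : ℕ, |(ratOf (A (i, j, n)) : ℝ) - dist (ideal i) (ideal j)| ≤ (1 / 2) ^ n

/-- The real line, with the rational numbers as ideal points. -/
noncomputable instance instComputableMetricSpaceReal : ComputableMetricSpace ℝ where
  ideal n := (ratOf n : ℝ)
  dense_ideal := Rat.isDenseEmbedding_coe_real.dense.comp ratOf_surjective.denseRange
    Rat.continuous_coe_real
  dist_computable := by
    refine ⟨fun p => ratDistCode p.1 p.2.1, ?_, fun i j n => ?_⟩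
    · exact (ratDistCode_primrec.comp Primrec.fst (Primrec.fst.comp Primrec.snd)).to_comp
    · simp only [ratOf_ratDistCode, Real.dist_eq]
      push_cast
      rw [sub_self, abs_zero]
      positivity

section ComputableMetricSpace

variable {X : Type*} [MetricSpace X] [ComputableMetricSpace X]
variable {Y : Type*} [MetricSpace Y] [ComputableMetricSpace Y]

/-- The effective numbering of the ideal balls: centre an ideal point, radius a positive
rational. -/
def idealBall (X : Type*) [MetricSpace X] [ComputableMetricSpace X] (n : ℕ) : Set X :=
  Metric.ball (ComputableMetricSpace.ideal n.unpair.1) (posRatOf n.unpair.2 : ℝ)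

/-- A computable point is the limit of a computable, fast converging sequence of ideal points. -/
def IsComputablePoint (x : X) : Prop :=
  ∃ a : ℕ → ℕ, Computable a ∧
    ∀ n : ℕ, dist (ComputableMetricSpace.ideal (a n)) x ≤ (1 / 2) ^ n

/-- A sequence of uniformly constructive open sets: one (partial) algorithm enumerates, for each
`i`, ideal balls whose union is `U i`. Divergent inputs contribute nothing. -/
def UniformlyConstructiveOpen (U : ℕ → Set X) : Prop :=
  ∃ A : ℕ → ℕ →. ℕ, Partrec₂ A ∧ ∀ i : ℕ, U i = ⋃ (n : ℕ) (k ∈ A i n), idealBall X k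

/-- A constructive `G_δ`-set. -/
def IsConstructiveGδ (D : Set X) : Prop :=
  ∃ U : ℕ → Set X, UniformlyConstructiveOpen U ∧ D = ⋂ n, U n

/-- `f` is computable on `D`. -/
def IsComputableOn (f : X → Y) (D : Set X) : Prop :=
  ∃ U : ℕ → Set X, UniformlyConstructiveOpen U ∧ ∀ i : ℕ, f ⁻¹' (idealBall Y i) ∩ D = U i ∩ D

/-- A sequence of nonnegative reals is effectively summable: from a rational `ε > 0` one can
compute an index from which on the tail of the series is at most `ε`. -/
def EffectivelySummable (a : ℕ → ℝ) : Prop :=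
  (∀ i, 0 ≤ a i) ∧ Summable a ∧
    ∃ N : ℕ → ℕ, Computable N ∧ ∀ k : ℕ, ∑' i, a (N k + i) ≤ (posRatOf k : ℝ)

variable [MeasurableSpace X]

/-- The ideal measure `∑ w • δ_s` of a finite list of pairs (code of an ideal point `s`, code of a
positive rational weight `w`). -/
noncomputable def idealMeasure (X : Type*) [MetricSpace X] [ComputableMetricSpace X]
    [MeasurableSpace X] (l : List (ℕ × ℕ)) : Measure X :=
  (l.map fun p => ENNReal.ofReal (posRatOf p.2 : ℝ) •
    Measure.dirac (ComputableMetricSpace.ideal p.1 : X)).sum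

/-- A measure is computable if it is the limit, in the Prokhorov metric, of a computable fast
sequence of ideal probability measures. -/
def IsComputableMeasure (μ : Measure X) : Prop :=
  ∃ A : ℕ → List (ℕ × ℕ), Computable A ∧ ∀ n : ℕ,
    IsProbabilityMeasure (idealMeasure X (A n)) ∧
      levyProkhorovEDist (idealMeasure X (A n)) μ ≤ ENNReal.ofReal ((1 / 2) ^ n)

/-- `f` is `δ` a.e.-computable: computable on a constructive `G_δ`-set of measure one. -/
def IsDeltaAEComputable (μ : Measure X) (f : X → Y) : Prop :=
  ∃ D : Set X, IsConstructiveGδ D ∧ μ D = 1 ∧ IsComputableOn f D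

/-- A constructive Borel–Cantelli set. -/
def IsConstructiveBorelCantelli (μ : Measure X) (R : Set X) : Prop :=
  ∃ U : ℕ → Set X, UniformlyConstructiveOpen U ∧
    EffectivelySummable (fun n => μ.real (U n)ᶜ) ∧ R = ⋃ k : ℕ, ⋂ n ≥ k, U n

/-- A computable dynamical system: a computable probability space with a measure-preserving,
`δ` a.e.-computable transformation. -/
structure IsComputableDynamicalSystem (T : X → X) (μ : Measure X) : Prop where
  isProbabilityMeasure : IsProbabilityMeasure μ
  isComputableMeasure : IsComputableMeasure μ
  measurePreserving : MeasurePreserving T μ μ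
  isDeltaAEComputable : IsDeltaAEComputable μ T

end ComputableMetricSpace

/-- `ln²`-ergodicity for observables in `𝓑`. -/
def IsLnSqErgodic {X : Type*} [MeasurableSpace X] (T : X → X) (μ : Measure X)
    (𝓑 : Set (X → ℝ)) : Prop :=
  ∀ φ ∈ 𝓑, ∀ ψ ∈ 𝓑, ∃ c : ℝ, 0 < c ∧ ∀ n : ℕ, 2 ≤ n →
    |(1 / (n : ℝ)) * ∑ i ∈ Finset.range n, ∫ x, φ (T^[i] x) * ψ x ∂μ
        - (∫ x, φ x ∂μ) * (∫ x, ψ x ∂μ)| ≤ c / (Real.log n) ^ 2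

/-- `x` is typical for the observable `φ`: the Birkhoff averages at `x` converge to `∫ φ dμ`. -/
def IsTypical {X : Type*} [MeasurableSpace X] (T : X → X) (μ : Measure X) (φ : X → ℝ)
    (x : X) : Prop :=
  Tendsto (fun n : ℕ => birkhoffAverage ℝ T φ n x) atTop (𝓝 (∫ y, φ y ∂μ))

/-! Centre `φ` and expand the second moment of its Birkhoff sum `S_n`. Invariance of the measure
turns it into a double sum of self-correlations, and the `ln²` hypothesis makes this `O(n² / ln²
n)`. Chebyshev's inequality then bounds the probability of a deviation `n * δ` by `C / (δ² ln² n)`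
(`exists_deviation_bound`). This is not summable over all `n` for fixed `δ`, but it is along
`samplingTime`. With `s_i` = `slowRoot i` of order `i^(1/8)`, the sampling times satisfy `ln n_i ≥ i
/ (2 s_i)`, so `δ_i = 1 / s_i` gives deviation probabilities `O(s_i⁴ / i²) = O(i^(-3/2))`, with
explicit tails. Since `n_(i+1) / n_i → 1` and `φ` is bounded, convergence along the `n_i` gives
convergence of all averages.

The good events must also be constructive open. On a forward invariant full-measure constructive
`G_δ`-set, preimages under iterates of `T` are obtained by pulling codes of balls back repeatedly
(`IsComputableOn.exists_invariant_core`), so closeness of `S_n` to `n * q` is constructive open for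
rational `q`. The integral is replaced by rationals `q_i` found by search: `q_i` is accepted once
the event that `S_n / n` is near `q_i` has measure above `1 / 2`. This is semidecidable because
measures of constructive open sets are lower semicomputable
(`IsComputableMeasure.re_lt_measureReal`), and it forces `q_i` to be close to the integral. The
`G_δ`-set itself is absorbed by intersecting the `i`-th event with its first `i + 1` open sets.

For a computable point, take a tail intersection `S` of positive measure and choose nested balls,
each meeting `S` in positive measure and the next ones passing through the successive open sets.
Positivity of the measure of a ball within `S` is semidecidable, because effective summability
bounds what the infinitely many remaining constraints can remove. Hence the balls can be found by
search, and completeness provides their common point. -/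

/-! ### Closure properties of recursively enumerable predicates -/

section Computability

variable {α β γ : Type*} [Primcodable α] [Primcodable β] [Primcodable γ]

/-- Running a program with a step budget is primitive recursive and monotone in the budget.
Monotonicity lets finitely many searches share one budget, as `REPred.forall_lt` needs. -/
theorem REPred.exists_primrec {p : α → Prop} (hp : REPred p) :
    ∃ f : α → ℕ → Bool, Primrec₂ f ∧ (∀ a, p a ↔ ∃ n, f a n = true) ∧
      ∀ a m n, m ≤ n → f a m = true → f a n = true := by
  obtain ⟨c, hc⟩ := Nat.Partrec.Code.exists_code.1 hp
  refine ⟨fun a n => (Nat.Partrec.Code.evaln n c (Encodable.encode a)).isSome, ?_, ?_, ?_⟩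
  · exact Primrec.option_isSome.comp (Nat.Partrec.Code.primrec_evaln.comp
      (Primrec.pair (Primrec.pair Primrec.snd (Primrec.const c))
        (Primrec.encode.comp Primrec.fst)))
  · intro a
    have h1 : p a ↔ ∃ x, x ∈ Nat.Partrec.Code.eval c (Encodable.encode a) := by
      rw [hc]
      simp [Part.mem_assert_iff]
    rw [h1]
    constructor
    · rintro ⟨x, hx⟩
      obtain ⟨k, hk⟩ := Nat.Partrec.Code.evaln_complete.1 hx
      exact ⟨k, Option.isSome_iff_exists.2 ⟨x, hk⟩⟩
    · rintro ⟨n, hn⟩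
      obtain ⟨x, hx⟩ := Option.isSome_iff_exists.1 hn
      exact ⟨x, Nat.Partrec.Code.evaln_sound hx⟩
  · intro a m n hmn h
    obtain ⟨x, hx⟩ := Option.isSome_iff_exists.1 h
    exact Option.isSome_iff_exists.2 ⟨x, Nat.Partrec.Code.evaln_mono hmn hx⟩

theorem REPred.comp {p : β → Prop} (hp : REPred p) {f : α → β} (hf : Computable f) :
    REPred fun a => p (f a) :=
  Partrec.comp hp hf

theorem ComputablePred.comp' {p : β → Prop} (hp : ComputablePred p) {f : α → β}
    (hf : Computable f) : ComputablePred fun a => p (f a) := by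
  obtain ⟨_, h⟩ := hp
  exact ⟨fun a => inferInstance, h.comp hf⟩

/-- A recursively enumerable relation has a partial computable selection function, defined
wherever a witness exists. -/
theorem REPred.exists_selection {p : α → β → Prop} (hp : REPred fun x : α × β => p x.1 x.2) :
    ∃ g : α →. β, Partrec g ∧ (∀ a, ∀ b ∈ g a, p a b) ∧ ∀ a, (∃ b, p a b) → (g a).Dom := by
  obtain ⟨f, hf, hpf, -⟩ := hp.exists_primrec
  -- Dovetailing: `n` codes a candidate witness together with a step budget for verifying it.
  let F : α → ℕ → Option β := fun a n =>
    (Encodable.decode (α := β) n.unpair.1).bind fun b => bif f (a, b) n.unpair.2 then some b else none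
  have hF : Computable₂ F := by
    have h2 : Primrec₂ F := by
      refine Primrec.option_bind (Primrec.decode.comp (Primrec.fst.comp
        (Primrec.unpair.comp Primrec.snd))) ?_
      refine Primrec.cond (hf.comp (Primrec.pair (Primrec.fst.comp Primrec.fst) Primrec.snd)
        (Primrec.snd.comp (Primrec.unpair.comp (Primrec.snd.comp Primrec.fst))))
        (Primrec.option_some.comp Primrec.snd) (Primrec.const none)
    exact h2.to_comp
  refine ⟨fun a => Nat.rfindOpt (F a), Partrec.rfindOpt hF, ?_, ?_⟩
  · intro a b hb
    obtain ⟨n, hn⟩ := Nat.rfindOpt_spec hb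
    simp only [F, Option.mem_def, Option.bind_eq_some_iff] at hn
    obtain ⟨b', -, hb'⟩ := hn
    cases hfb : f (a, b') n.unpair.2
    · simp [hfb] at hb'
    · simp only [hfb, cond_true, Option.some.injEq] at hb'
      subst hb'
      exact (hpf (a, b')).2 ⟨_, hfb⟩
  · rintro a ⟨b, hb⟩
    obtain ⟨n, hn⟩ := (hpf (a, b)).1 hb
    refine Nat.rfindOpt_dom.2 ⟨Nat.pair (Encodable.encode b) n, b, ?_⟩
    simp [F, hn]

theorem REPred.ex {p : α → β → Prop} (hp : REPred fun x : α × β => p x.1 x.2) :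
    REPred fun a => ∃ b, p a b := by
  obtain ⟨g, hg, h1, h2⟩ := hp.exists_selection
  exact hg.dom_re.of_eq fun a => ⟨fun h => ⟨_, h1 a _ (Part.get_mem h)⟩, h2 a⟩

theorem REPred.exists_computable_choice {p : α → β → Prop}
    (hp : REPred fun x : α × β => p x.1 x.2) (h : ∀ a, ∃ b, p a b) :
    ∃ g : α → β, Computable g ∧ ∀ a, p a (g a) := by
  obtain ⟨g, hg, h1, h2⟩ := hp.exists_selection
  exact ⟨fun a => (g a).get (h2 a (h a)), hg.of_eq_tot fun a => Part.get_mem _,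
    fun a => h1 a _ (Part.get_mem _)⟩

/-- Computable dependent choice for recursively enumerable relations. -/
theorem REPred.exists_computable_chain {r : ℕ → β → β → Prop} {P : β → Prop}
    (hr : REPred fun x : (ℕ × β) × β => r x.1.1 x.1.2 x.2) {b₀ : β} (h₀ : P b₀)
    (hs : ∀ n b, P b → ∃ b', r n b b') (hP : ∀ n b b', r n b b' → P b') :
    ∃ a : ℕ → β, Computable a ∧ a 0 = b₀ ∧ ∀ n, r n (a n) (a (n + 1)) := by
  obtain ⟨g, hg, h1, h2⟩ :=
    REPred.exists_selection (p := fun (x : ℕ × β) b' => r x.1 x.2 b') hr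
  -- The recursion is a priori partial; the invariant `P` guarantees a successor at each stage, so
  -- it is total.
  let G : ℕ →. β := fun n => n.rec (Part.some b₀) fun k IH => IH.bind fun b => g (k, b)
  have hG : Partrec G := by
    refine Partrec.nat_rec (f := fun n : ℕ => n) (g := fun _ => Part.some b₀)
      (h := fun _ x => g x) Computable.id (Computable.const b₀).partrec ?_
    exact hg.comp Computable.snd
  have hG' : ∀ n, ∃ h : (G n).Dom, P ((G n).get h) := by
    intro n
    induction n with
    | zero => exact ⟨trivial, h₀⟩
    | succ k ih =>
      obtain ⟨h, hP'⟩ := ih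
      have hd : (g (k, (G k).get h)).Dom := h2 _ (hs k _ hP')
      have hm : (g (k, (G k).get h)).get hd ∈ G (k + 1) :=
        Part.mem_bind (Part.get_mem h) (Part.get_mem hd)
      refine ⟨Part.dom_iff_mem.2 ⟨_, hm⟩, ?_⟩
      rw [Part.get_eq_of_mem hm]
      exact hP k _ _ (h1 _ _ (Part.get_mem hd))
  choose hd hPd using hG'
  refine ⟨fun n => (G n).get (hd n), hG.of_eq_tot fun n => Part.get_mem _, rfl, fun k => ?_⟩
  have hdg : (g (k, (G k).get (hd k))).Dom := h2 _ (hs k _ (hPd k))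
  have hm : (g (k, (G k).get (hd k))).get hdg ∈ G (k + 1) :=
    Part.mem_bind (Part.get_mem (hd k)) (Part.get_mem hdg)
  change r k _ ((G (k + 1)).get (hd (k + 1)))
  rw [Part.get_eq_of_mem hm (hd (k + 1))]
  exact h1 _ _ (Part.get_mem hdg)

theorem REPred.and {p q : α → Prop} (hp : REPred p) (hq : REPred q) :
    REPred fun a => p a ∧ q a := by
  have : Partrec fun a => (Part.assert (p a) fun _ => Part.some ()).bind
      fun _ => Part.assert (q a) fun _ => Part.some () :=
    Partrec.bind hp (hq.comp Computable.fst)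
  exact this.dom_re.of_eq fun a => by simp [Part.assert]

theorem REPred.or {p q : α → Prop} (hp : REPred p) (hq : REPred q) :
    REPred fun a => p a ∨ q a := by
  obtain ⟨f, hf, hpf, -⟩ := hp.exists_primrec
  obtain ⟨g, hg, hqg, -⟩ := hq.exists_primrec
  have h : REPred fun x : α × ℕ => (f x.1 x.2 || g x.1 x.2) = true :=
    ComputablePred.to_re (ComputablePred.computable_iff.2
      ⟨_, (Primrec.or.comp hf hg).to_comp, rfl⟩)
  refine (REPred.ex (p := fun a n => (f a n || g a n) = true) h).of_eq fun a => ?_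
  simp only [hpf, hqg, Bool.or_eq_true, exists_or]

/-- The maximum of the finitely many budgets serves every `i < m a`, so the bounded quantifier moves
inside one existential over a decidable relation. -/
theorem REPred.forall_lt {p : α → ℕ → Prop} (hp : REPred fun x : α × ℕ => p x.1 x.2)
    {m : α → ℕ} (hm : Computable m) : REPred fun a => ∀ i < m a, p a i := by
  obtain ⟨f, hf, hpf, hmono⟩ := hp.exists_primrec
  have h1 : PrimrecRel fun (i : ℕ) (y : α × ℕ) => f (y.1, i) y.2 = true :=
    PrimrecPred.of_eq (Primrec.eq.comp (hf.comp (Primrec.pair (Primrec.fst.comp Primrec.snd)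
      Primrec.fst) (Primrec.snd.comp Primrec.snd)) (Primrec.const true)) fun _ => Iff.rfl
  have h2 : PrimrecRel fun (n : ℕ) (y : α × ℕ) => ∀ i < n, f (y.1, i) y.2 = true :=
    (h1.forall_mem_list.comp (Primrec.list_range.comp Primrec.fst) Primrec.snd).of_eq
      fun _ => by simp
  have h3 : ComputablePred fun x : α × ℕ => ∀ i < m x.1, f (x.1, i) x.2 = true :=
    ComputablePred.comp' (PrimrecPred.computablePred h2)
      (Computable.pair (hm.comp Computable.fst) Computable.id)
  refine (REPred.ex (p := fun a n => ∀ i < m a, f (a, i) n = true) h3.to_re).of_eq fun a => ?_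
  constructor
  · rintro ⟨n, hn⟩ i hi
    exact (hpf (a, i)).2 ⟨n, hn i hi⟩
  · intro h
    choose! N hN using fun i hi => (hpf (a, i)).1 (h i hi)
    refine ⟨(Finset.range (m a)).sup N, fun i hi => hmono _ _ _ ?_ (hN i hi)⟩
    exact Finset.le_sup (f := N) (Finset.mem_range.2 hi)

theorem Computable.add {f g : α → ℕ} (hf : Computable f) (hg : Computable g) :
    Computable fun a => f a + g a := Primrec.nat_add.to_comp.comp hf hg

theorem Computable.mul {f g : α → ℕ} (hf : Computable f) (hg : Computable g) :
    Computable fun a => f a * g a := Primrec.nat_mul.to_comp.comp hf hg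

theorem Computable.natPair {f g : α → ℕ} (hf : Computable f) (hg : Computable g) :
    Computable fun a => Nat.pair (f a) (g a) := Primrec₂.natPair.to_comp.comp hf hg

theorem Computable.unpair₁ {f : α → ℕ} (hf : Computable f) :
    Computable fun a => (f a).unpair.1 := Computable.fst.comp (Computable.unpair.comp hf)

theorem Computable.unpair₂ {f : α → ℕ} (hf : Computable f) :
    Computable fun a => (f a).unpair.2 := Computable.snd.comp (Computable.unpair.comp hf)

theorem REPred.nat_eq {f g : α → ℕ} (hf : Computable f) (hg : Computable g) :
    REPred fun a => f a = g a :=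
  ComputablePred.to_re (ComputablePred.comp' (p := fun x : ℕ × ℕ => x.1 = x.2)
    (PrimrecPred.computablePred (Primrec.eq (α := ℕ))) (hf.pair hg))

/-- A uniformly computable family of rational numbers. -/
def RatComputable (r : α → ℚ) : Prop :=
  ∃ c : α → ℕ, Computable c ∧ ∀ a, ratOf (c a) = r a

theorem ratComputable_iff {r : α → ℚ} : RatComputable r ↔
    ∃ a b c : α → ℕ, Computable a ∧ Computable b ∧ Computable c ∧
      ∀ x, r x = ((a x : ℚ) - b x) / (c x + 1) := by
  constructor
  · rintro ⟨c, hc, h⟩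
    exact ⟨_, _, _, hc.unpair₁, hc.unpair₂.unpair₁, hc.unpair₂.unpair₂, fun x => (h x).symm⟩
  · rintro ⟨a, b, c, ha, hb, hc, h⟩
    exact ⟨_, ha.natPair (hb.natPair hc), fun x => by simp [ratOf, h]⟩

/-! ### Arithmetic and order on computable families of rationals -/

namespace RatComputable

theorem ratOf {c : α → ℕ} (hc : Computable c) : RatComputable fun a => ratOf (c a) :=
  ⟨c, hc, fun _ => rfl⟩

theorem comp {r : β → ℚ} (hr : RatComputable r) {f : α → β} (hf : Computable f) :
    RatComputable fun a => r (f a) := by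
  obtain ⟨c, hc, h⟩ := hr
  exact ⟨_, hc.comp hf, fun a => h (f a)⟩

theorem const (q : ℚ) : RatComputable fun _ : α => q := by
  obtain ⟨c, hc⟩ := ratOf_surjective q
  exact ⟨_, Computable.const c, fun _ => hc⟩

theorem natCast {f : α → ℕ} (hf : Computable f) : RatComputable fun a => (f a : ℚ) :=
  ratComputable_iff.2 ⟨f, fun _ => 0, fun _ => 0, hf, Computable.const 0, Computable.const 0,
    fun x => by simp⟩

theorem inv_succ {f : α → ℕ} (hf : Computable f) : RatComputable fun a => 1 / ((f a : ℚ) + 1) :=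
  ratComputable_iff.2 ⟨fun _ => 1, fun _ => 0, f, Computable.const 1, Computable.const 0, hf,
    fun x => by simp⟩

theorem neg {r : α → ℚ} (hr : RatComputable r) : RatComputable fun a => - r a := by
  obtain ⟨a, b, c, ha, hb, hc, h⟩ := ratComputable_iff.1 hr
  exact ratComputable_iff.2 ⟨b, a, c, hb, ha, hc, fun x => by rw [h]; ring⟩

theorem add {r s : α → ℚ} (hr : RatComputable r) (hs : RatComputable s) :
    RatComputable fun a => r a + s a := by
  obtain ⟨a, b, c, ha, hb, hc, h⟩ := ratComputable_iff.1 hr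
  obtain ⟨a', b', c', ha', hb', hc', h'⟩ := ratComputable_iff.1 hs
  refine ratComputable_iff.2 ⟨_, _, _,
    (ha.mul (Computable.succ.comp hc')).add (ha'.mul (Computable.succ.comp hc)),
    (hb.mul (Computable.succ.comp hc')).add (hb'.mul (Computable.succ.comp hc)),
    -- Codes store the denominator minus one, and `(c + 1) * (c' + 1) - 1 = c * c' + (c + c')`.
    (hc.mul hc').add (hc.add hc'), fun x => ?_⟩
  rw [h, h']
  have h1 : (c x : ℚ) + 1 ≠ 0 := by positivity
  have h2 : (c' x : ℚ) + 1 ≠ 0 := by positivity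
  have h3 : (c x : ℚ) * c' x + (c x + c' x) + 1 = (c x + 1) * (c' x + 1) := by ring
  push_cast
  rw [h3]
  field_simp
  ring

theorem sub {r s : α → ℚ} (hr : RatComputable r) (hs : RatComputable s) :
    RatComputable fun a => r a - s a := by
  simpa only [sub_eq_add_neg] using hr.add hs.neg

theorem mul {r s : α → ℚ} (hr : RatComputable r) (hs : RatComputable s) :
    RatComputable fun a => r a * s a := by
  obtain ⟨a, b, c, ha, hb, hc, h⟩ := ratComputable_iff.1 hr
  obtain ⟨a', b', c', ha', hb', hc', h'⟩ := ratComputable_iff.1 hs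
  refine ratComputable_iff.2 ⟨_, _, _, (ha.mul ha').add (hb.mul hb'),
    (ha.mul hb').add (hb.mul ha'),
    (hc.mul hc').add (hc.add hc'), fun x => ?_⟩
  rw [h, h']
  have h1 : (c x : ℚ) + 1 ≠ 0 := by positivity
  have h2 : (c' x : ℚ) + 1 ≠ 0 := by positivity
  have h3 : (c x : ℚ) * c' x + (c x + c' x) + 1 = (c x + 1) * (c' x + 1) := by ring
  push_cast
  rw [h3]
  field_simp
  ring

theorem posRatOf {f : α → ℕ} (hf : Computable f) : RatComputable fun a => posRatOf (f a) :=
  ratComputable_iff.2 ⟨fun a => (f a).unpair.1 + 1, fun _ => 0, fun a => (f a).unpair.2,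
    Computable.succ.comp hf.unpair₁, Computable.const 0, hf.unpair₂,
    fun x => by simp [_root_.posRatOf]⟩

/-- The recursion runs on codes, so the step need only be computable from a code of the previous
value; which code represents that value is irrelevant. -/
theorem nat_rec {f : α → ℚ} (hf : RatComputable f) {g : α → ℕ → ℚ → ℚ}
    (hg : RatComputable fun x : (α × ℕ) × ℕ => g x.1.1 x.1.2 (_root_.ratOf x.2)) {m : α → ℕ}
    (hm : Computable m) :
    RatComputable fun a => (m a).rec (f a) fun k q => g a k q := by
  obtain ⟨c, hc, h⟩ := hf
  obtain ⟨d, hd, h'⟩ := hg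
  refine ⟨fun a => (m a).rec (c a) fun k e => d ((a, k), e), ?_, fun a => ?_⟩
  · exact Computable.nat_rec (h := fun a x => d ((a, x.1), x.2)) hm hc
      (hd.comp (Computable.pair (Computable.pair Computable.fst
      (Computable.fst.comp Computable.snd)) (Computable.snd.comp Computable.snd))).to₂
  · dsimp only
    induction m a with
    | zero => exact h a
    | succ k ih =>
      dsimp only
      rw [h']
      dsimp only
      rw [ih]

theorem sum_range {r : α → ℕ → ℚ} (hr : RatComputable fun x : α × ℕ => r x.1 x.2) {m : α → ℕ}
    (hm : Computable m) : RatComputable fun a => ∑ i ∈ Finset.range (m a), r a i := by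
  have h := nat_rec (f := fun _ : α => 0) (const 0) (g := fun a k q => q + r a k)
    ((ratOf Computable.snd).add (hr.comp Computable.fst)) hm
  convert h using 2 with a
  induction m a with
  | zero => simp
  | succ k ih => rw [Finset.sum_range_succ, ih]

theorem pow {q : ℚ} {m : α → ℕ} (hm : Computable m) : RatComputable fun a => q ^ m a := by
  have h := nat_rec (f := fun _ : α => 1) (const 1) (g := fun _ _ p => p * q)
    ((ratOf Computable.snd).mul (const q)) hm
  convert h using 2 with a
  induction m a with
  | zero => simp
  | succ k ih => rw [pow_succ, ih]

theorem lt {r s : α → ℚ} (hr : RatComputable r) (hs : RatComputable s) :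
    ComputablePred fun a => r a < s a := by
  obtain ⟨a, b, c, ha, hb, hc, h⟩ := ratComputable_iff.1 hr
  obtain ⟨a', b', c', ha', hb', hc', h'⟩ := ratComputable_iff.1 hs
  have key : ComputablePred fun x => a x * (c' x + 1) + b' x * (c x + 1) <
      a' x * (c x + 1) + b x * (c' x + 1) :=
    ComputablePred.comp' (p := fun x : ℕ × ℕ => x.1 < x.2)
      (PrimrecPred.computablePred Primrec.nat_lt)
      (((ha.mul (Computable.succ.comp hc')).add (hb'.mul (Computable.succ.comp hc))).pair
        ((ha'.mul (Computable.succ.comp hc)).add (hb.mul (Computable.succ.comp hc'))))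
  refine key.of_eq fun x => ?_
  rw [h, h', div_lt_div_iff₀ (by positivity) (by positivity), ← Nat.cast_lt (α := ℚ)]
  push_cast
  constructor <;> intro h <;> linarith

theorem re_lt {r s : α → ℚ} (hr : RatComputable r) (hs : RatComputable s) :
    REPred fun a => r a < s a := (hr.lt hs).to_re

theorem ite {p : α → Bool} (hp : Computable p) {r s : α → ℚ} (hr : RatComputable r)
    (hs : RatComputable s) : RatComputable fun a => if p a = true then r a else s a := by
  obtain ⟨c, hc, h⟩ := hr
  obtain ⟨d, hd, h'⟩ := hs
  refine ⟨_, Computable.cond hp hc hd, fun a => ?_⟩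
  cases hpa : p a <;> simp [h, h', hpa]

end RatComputable

theorem exists_posRatOf_eq {q : ℚ} (hq : 0 < q) : ∃ n, posRatOf n = q := by
  have hn : 0 < q.num := Rat.num_pos.2 hq
  refine ⟨Nat.pair (q.num.toNat - 1) (q.den - 1), ?_⟩
  simp only [posRatOf, Nat.unpair_pair]
  have h1 : ((q.num.toNat - 1 : ℕ) : ℚ) + 1 = q.num := by
    have : q.num.toNat - 1 + 1 = q.num.toNat := by omega
    have h2 : ((q.num.toNat : ℕ) : ℤ) = q.num := Int.toNat_of_nonneg hn.le
    calc ((q.num.toNat - 1 : ℕ) : ℚ) + 1 = ((q.num.toNat : ℕ) : ℚ) := by exact_mod_cast this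
      _ = q.num := by exact_mod_cast h2
  have hd : ((q.den - 1 : ℕ) : ℚ) + 1 = q.den := by
    exact_mod_cast Nat.sub_add_cancel q.den_pos
  rw [h1, hd, Rat.num_div_den]

theorem posRatOf_pos (n : ℕ) : 0 < posRatOf n := by unfold posRatOf; positivity

end Computability

/-! ### Constructive open sets and formal inclusion of balls -/

section ConstructiveOpen

variable {X : Type*} [MetricSpace X] [ComputableMetricSpace X]
variable {Y : Type*} [MetricSpace Y] [ComputableMetricSpace Y]
variable {α β : Type*} [Primcodable α] [Primcodable β]

/-- A strict upper bound on a computable real is eventually witnessed by a rational approximation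
plus its error, once the error is below half the gap. -/
theorem re_dist_ideal_lt {f g : α → ℕ} (hf : Computable f) (hg : Computable g) {r : α → ℚ}
    (hr : RatComputable r) :
    REPred fun a => dist (ComputableMetricSpace.ideal (f a) : X)
      (ComputableMetricSpace.ideal (g a)) < (r a : ℝ) := by
  obtain ⟨A, hA, h⟩ := ComputableMetricSpace.dist_computable (X := X)
  have h1 : REPred fun x : α × ℕ => ratOf (A (f x.1, g x.1, x.2)) + (1 / 2 : ℚ) ^ x.2 < r x.1 :=
    RatComputable.re_lt ((RatComputable.ratOf (hA.comp ((hf.comp Computable.fst).pair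
      ((hg.comp Computable.fst).pair Computable.snd)))).add (RatComputable.pow Computable.snd))
      (hr.comp Computable.fst)
  refine (REPred.ex (p := fun a n => ratOf (A (f a, g a, n)) + (1 / 2 : ℚ) ^ n < r a) h1).of_eq
    fun a => ?_
  constructor
  · rintro ⟨n, hn⟩
    have hn' : ((ratOf (A (f a, g a, n)) : ℝ)) + (1 / 2 : ℝ) ^ n < r a := by
      simpa using (Rat.cast_lt (K := ℝ)).2 hn
    have := (abs_le.1 (h (f a) (g a) n)).1
    linarith
  · intro hd
    obtain ⟨n, hn⟩ := exists_pow_lt_of_lt_one (half_pos (sub_pos.2 hd))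
      (by norm_num : (1 / 2 : ℝ) < 1)
    refine ⟨n, ?_⟩
    have := (abs_le.1 (h (f a) (g a) n)).2
    have h2 : ((ratOf (A (f a, g a, n)) : ℝ)) + (1 / 2 : ℝ) ^ n < r a := by linarith
    exact (Rat.cast_lt (K := ℝ)).1 (by simpa using h2)

/-- The centre of an ideal ball. -/
def ballCenter (X : Type*) [MetricSpace X] [ComputableMetricSpace X] (k : ℕ) : X :=
  ComputableMetricSpace.ideal k.unpair.1

/-- The radius of an ideal ball. -/
def ballRadius (k : ℕ) : ℚ := posRatOf k.unpair.2

theorem mem_idealBall {x : X} {k : ℕ} :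
    x ∈ idealBall X k ↔ dist x (ballCenter X k) < ballRadius k := Iff.rfl

theorem RatComputable.ballRadius {f : α → ℕ} (hf : Computable f) :
    RatComputable fun a => ballRadius (f a) := RatComputable.posRatOf hf.unpair₂

/-- Formal inclusion of ideal balls. -/
def FormalIncl (X : Type*) [MetricSpace X] [ComputableMetricSpace X] (k l : ℕ) : Prop :=
  dist (ballCenter X k) (ballCenter X l) < ((ballRadius l - ballRadius k : ℚ) : ℝ)

theorem FormalIncl.subset {k l : ℕ} (h : FormalIncl X k l) : idealBall X k ⊆ idealBall X l := by
  intro x hx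
  rw [mem_idealBall] at hx ⊢
  have := dist_triangle x (ballCenter X k) (ballCenter X l)
  unfold FormalIncl at h
  push_cast at h
  linarith

/-- Semidecidability is the reason to use a strict inequality between centres and radii in place of
inclusion of sets. -/
theorem re_formalIncl {f g : α → ℕ} (hf : Computable f) (hg : Computable g) :
    REPred fun a => FormalIncl X (f a) (g a) :=
  re_dist_ideal_lt hf.unpair₁ hg.unpair₁
    ((RatComputable.ballRadius hg).sub (RatComputable.ballRadius hf))

/-- Every point of a finite intersection of ideal balls lies in arbitrarily small ideal balls that
are formally included in all of them. -/
theorem exists_idealBall_formalIncl (x : X) (F : Finset ℕ) (hF : ∀ l ∈ F, x ∈ idealBall X l)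
    {ε : ℝ} (hε : 0 < ε) :
    ∃ k, x ∈ idealBall X k ∧ (∀ l ∈ F, FormalIncl X k l) ∧ (ballRadius k : ℝ) < ε := by
  -- The slack is spent twice, on moving the centre away from `x` and on the radius of the new ball;
  -- both are at most `η`.
  have hev : ∀ᶠ η : ℝ in 𝓝[>] 0, (∀ l ∈ F, 2 * η < ballRadius l - dist x (ballCenter X l)) ∧
      η < ε := by
    refine Filter.Eventually.and ((Finset.eventually_all F).2 fun l hl => ?_) ?_
    · have h1 : 0 < (ballRadius l : ℝ) - dist x (ballCenter X l) :=
        sub_pos.2 (mem_idealBall.1 (hF l hl))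
      have h2 : Tendsto (fun η : ℝ => 2 * η) (𝓝[>] 0) (𝓝 (2 * 0)) :=
        (tendsto_nhdsWithin_of_tendsto_nhds tendsto_id).const_mul 2
      rw [mul_zero] at h2
      exact h2.eventually_lt_const h1
    · exact (tendsto_nhdsWithin_of_tendsto_nhds tendsto_id).eventually_lt_const hε
  obtain ⟨η, ⟨h1, h2⟩, hη⟩ := (hev.and self_mem_nhdsWithin).exists
  obtain ⟨q, hq0, hqη⟩ := exists_rat_btwn (show (0 : ℝ) < η from hη)
  obtain ⟨c, hc⟩ := exists_posRatOf_eq (q := q) (by exact_mod_cast hq0)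
  obtain ⟨s, hs⟩ := (ComputableMetricSpace.dense_ideal (X := X)).exists_dist_lt x hq0
  have hr : ballRadius (Nat.pair s c) = q := by simp [ballRadius, hc]
  have hctr : ballCenter X (Nat.pair s c) = ComputableMetricSpace.ideal s := by simp [ballCenter]
  refine ⟨Nat.pair s c, ?_, fun l hl => ?_, ?_⟩
  · rw [mem_idealBall, hr, hctr]
    exact hs
  · have h3 := h1 l hl
    have := dist_triangle_left (ComputableMetricSpace.ideal s) (ballCenter X l) x
    unfold FormalIncl
    rw [hr, hctr]
    push_cast
    linarith
  · rw [hr]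
    linarith

/-- A family of constructive open sets, uniform in a parameter from a coded type. -/
def ConstructiveOpen (U : α → Set X) : Prop :=
  ∃ p : α → ℕ → Prop, REPred (fun x : α × ℕ => p x.1 x.2) ∧
    ∀ a x, x ∈ U a ↔ ∃ k, p a k ∧ x ∈ idealBall X k

/-- Passing from an enumerating algorithm to the recursively enumerable set of its outputs makes the
closure properties of `REPred` available. Conversely, an enumerable set of codes is listed by the
algorithm that outputs `n` once `n` is accepted. -/
theorem uniformlyConstructiveOpen_iff {U : ℕ → Set X} :
    UniformlyConstructiveOpen U ↔ ConstructiveOpen U := by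
  constructor
  · rintro ⟨A, hA, hU⟩
    refine ⟨fun i k => ∃ n, k ∈ A i n, ?_, fun i x => ?_⟩
    · refine REPred.ex (p := fun (x : ℕ × ℕ) n => x.2 ∈ A x.1 n) ?_
      have h : Partrec fun y : (ℕ × ℕ) × ℕ => (A y.1.1 y.2).bind fun m =>
          Part.assert (m = y.1.2) fun _ => Part.some () := by
        refine Partrec.bind (hA.comp (Computable.fst.comp Computable.fst) Computable.snd) ?_
        exact REPred.nat_eq (α := ((ℕ × ℕ) × ℕ) × ℕ) (f := fun z => z.2) (g := fun z => z.1.1.2)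
          Computable.snd (Computable.snd.comp (Computable.fst.comp Computable.fst))
      refine h.dom_re.of_eq fun y => ?_
      simp only [Part.dom_iff_mem, Part.mem_bind_iff, Part.mem_assert_iff]
      constructor
      · rintro ⟨-, m, hm, rfl, -⟩
        exact hm
      · intro hm
        exact ⟨(), _, hm, rfl, Part.mem_some _⟩
    · rw [hU]
      simp only [Set.mem_iUnion, exists_prop]
      constructor
      · rintro ⟨n, k, hk, hx⟩
        exact ⟨k, ⟨n, hk⟩, hx⟩
      · rintro ⟨k, ⟨n, hk⟩, hx⟩
        exact ⟨n, k, hk, hx⟩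
  · rintro ⟨p, hp, hU⟩
    refine ⟨fun i n => (Part.assert (p i n) fun _ => Part.some ()).map fun _ => n, ?_, fun i => ?_⟩
    · exact Partrec.map (f := fun x : ℕ × ℕ => Part.assert (p x.1 x.2) fun _ => Part.some ()) hp
        (Computable.snd.comp Computable.fst).to₂
    · ext x
      rw [hU]
      simp only [Set.mem_iUnion, exists_prop, Part.mem_map_iff, Part.mem_assert_iff]
      constructor
      · rintro ⟨k, hk, hx⟩
        exact ⟨k, k, ⟨(), ⟨hk, Part.mem_some _⟩, rfl⟩, hx⟩
      · rintro ⟨n, k, ⟨-, ⟨hk, -⟩, rfl⟩, hx⟩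
        exact ⟨n, hk, hx⟩

namespace ConstructiveOpen

theorem isOpen {U : α → Set X} (hU : ConstructiveOpen U) (a : α) : IsOpen (U a) := by
  obtain ⟨p, -, h⟩ := hU
  have : U a = ⋃ (k : ℕ) (_ : p a k), idealBall X k := by
    ext x
    simp [h]
  rw [this]
  exact isOpen_iUnion fun k => isOpen_iUnion fun _ => Metric.isOpen_ball

theorem idealBall {f : α → ℕ} (hf : Computable f) :
    ConstructiveOpen fun a => idealBall X (f a) :=
  ⟨fun a k => k = f a, REPred.nat_eq Computable.snd (hf.comp Computable.fst), fun a x => by simp⟩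

theorem comp {U : β → Set X} (hU : ConstructiveOpen U) {f : α → β} (hf : Computable f) :
    ConstructiveOpen fun a => U (f a) := by
  obtain ⟨p, hp, h⟩ := hU
  exact ⟨fun a k => p (f a) k,
    hp.comp (f := fun x : α × ℕ => (f x.1, x.2)) ((hf.comp Computable.fst).pair Computable.snd),
    fun a x => h (f a) x⟩

theorem iUnion {U : α → β → Set X} (hU : ConstructiveOpen fun x : α × β => U x.1 x.2) :
    ConstructiveOpen fun a => ⋃ b, U a b := by
  obtain ⟨p, hp, h⟩ := hU
  refine ⟨fun a k => ∃ b, p (a, b) k, ?_, fun a x => ?_⟩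
  · exact REPred.ex (p := fun (x : α × ℕ) b => p (x.1, b) x.2)
      (hp.comp (f := fun y : (α × ℕ) × β => ((y.1.1, y.2), y.1.2))
        (((Computable.fst.comp Computable.fst).pair Computable.snd).pair
          (Computable.snd.comp Computable.fst)))
  · simp only [Set.mem_iUnion]
    constructor
    · rintro ⟨b, hb⟩
      obtain ⟨k, hk, hx⟩ := (h (a, b) x).1 hb
      exact ⟨k, ⟨b, hk⟩, hx⟩
    · rintro ⟨k, ⟨b, hk⟩, hx⟩
      exact ⟨b, (h (a, b) x).2 ⟨k, hk, hx⟩⟩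

theorem guard {U : α → Set X} (hU : ConstructiveOpen U) {q : α → Prop} (hq : REPred q) :
    ConstructiveOpen fun a => {x | q a ∧ x ∈ U a} := by
  obtain ⟨p, hp, h⟩ := hU
  refine ⟨fun a k => q a ∧ p a k, (hq.comp Computable.fst).and hp, fun a x => ?_⟩
  rw [Set.mem_ofPred_eq, h]
  constructor
  · rintro ⟨h1, k, h2, h3⟩
    exact ⟨k, ⟨h1, h2⟩, h3⟩
  · rintro ⟨k, ⟨h1, h2⟩, h3⟩
    exact ⟨h1, k, h2, h3⟩

/-- A finite intersection is the union of the balls formally included in some listed ball of each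
set; `exists_idealBall_formalIncl` shows that no point is missed. -/
theorem iInter_lt {U : α → ℕ → Set X} (hU : ConstructiveOpen fun x : α × ℕ => U x.1 x.2)
    {m : α → ℕ} (hm : Computable m) : ConstructiveOpen fun a => {x | ∀ i < m a, x ∈ U a i} := by
  obtain ⟨p, hp, h⟩ := hU
  refine ⟨fun a k => ∀ i < m a, ∃ l, p (a, i) l ∧ FormalIncl X k l, ?_, fun a x => ?_⟩
  · refine REPred.forall_lt (p := fun (x : α × ℕ) i => ∃ l, p (x.1, i) l ∧ FormalIncl X x.2 l) ?_
      (hm.comp Computable.fst)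
    refine REPred.ex (p := fun (y : (α × ℕ) × ℕ) l => p (y.1.1, y.2) l ∧ FormalIncl X y.1.2 l) ?_
    refine REPred.and ?_ ?_
    · exact hp.comp (f := fun z : ((α × ℕ) × ℕ) × ℕ => ((z.1.1.1, z.1.2), z.2))
        (((Computable.fst.comp (Computable.fst.comp Computable.fst)).pair
          (Computable.snd.comp Computable.fst)).pair Computable.snd)
    · exact re_formalIncl (Computable.snd.comp (Computable.fst.comp Computable.fst)) Computable.snd
  · rw [Set.mem_ofPred_eq]
    constructor
    · intro hx
      choose! l hl hxl using fun i hi => (h (a, i) x).1 (hx i hi)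
      obtain ⟨k, hk, hF, -⟩ := exists_idealBall_formalIncl x ((Finset.range (m a)).image l)
        (by
          intro j hj
          obtain ⟨i, hi, rfl⟩ := Finset.mem_image.1 hj
          exact hxl i (Finset.mem_range.1 hi)) one_pos
      exact ⟨k, fun i hi => ⟨l i, hl i hi,
        hF _ (Finset.mem_image_of_mem _ (Finset.mem_range.2 hi))⟩, hk⟩
    · rintro ⟨k, hk, hx⟩ i hi
      obtain ⟨l, hl, hkl⟩ := hk i hi
      exact (h (a, i) x).2 ⟨l, hl, hkl.subset hx⟩

theorem inter {U V : α → Set X} (hU : ConstructiveOpen U) (hV : ConstructiveOpen V) :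
    ConstructiveOpen fun a => U a ∩ V a := by
  obtain ⟨p, hp, h⟩ := hU
  obtain ⟨q, hq, h'⟩ := hV
  refine ⟨fun a k => ∃ l l', (p a l ∧ q a l') ∧ FormalIncl X k l ∧ FormalIncl X k l', ?_,
    fun a x => ?_⟩
  · refine REPred.ex (p := fun (x : α × ℕ) l => ∃ l', (p x.1 l ∧ q x.1 l') ∧
      FormalIncl X x.2 l ∧ FormalIncl X x.2 l') ?_
    refine REPred.ex (p := fun (y : (α × ℕ) × ℕ) l' => (p y.1.1 y.2 ∧ q y.1.1 l') ∧
      FormalIncl X y.1.2 y.2 ∧ FormalIncl X y.1.2 l') ?_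
    have c1 : Computable fun z : ((α × ℕ) × ℕ) × ℕ => z.1.1.1 :=
      Computable.fst.comp (Computable.fst.comp Computable.fst)
    have c2 : Computable fun z : ((α × ℕ) × ℕ) × ℕ => z.1.1.2 :=
      Computable.snd.comp (Computable.fst.comp Computable.fst)
    have c3 : Computable fun z : ((α × ℕ) × ℕ) × ℕ => z.1.2 :=
      Computable.snd.comp Computable.fst
    exact REPred.and (REPred.and
      (hp.comp (f := fun z : ((α × ℕ) × ℕ) × ℕ => (z.1.1.1, z.1.2)) (c1.pair c3))
      (hq.comp (f := fun z : ((α × ℕ) × ℕ) × ℕ => (z.1.1.1, z.2)) (c1.pair Computable.snd)))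
      (REPred.and (re_formalIncl c2 c3) (re_formalIncl c2 Computable.snd))
  · rw [Set.mem_inter_iff, h, h']
    constructor
    · rintro ⟨⟨l, hl, hx⟩, l', hl', hx'⟩
      obtain ⟨k, hk, hF, -⟩ := exists_idealBall_formalIncl x {l, l'} (by simp [hx, hx']) one_pos
      exact ⟨k, ⟨l, l', ⟨hl, hl'⟩, hF l (by simp), hF l' (by simp)⟩, hk⟩
    · rintro ⟨k, ⟨l, l', ⟨hl, hl'⟩, hF, hF'⟩, hx⟩
      exact ⟨⟨l, hl, hF.subset hx⟩, l', hl', hF'.subset hx⟩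

end ConstructiveOpen

end ConstructiveOpen

/-! ### Lower semicomputability of the measure of constructive open sets -/

section ComputableMeasure

variable {X : Type*} [MetricSpace X] [ComputableMetricSpace X] [MeasurableSpace X]
variable {α : Type*} [Primcodable α]

open Classical in
theorem idealMeasure_apply (l : List (ℕ × ℕ)) {H : Set X} (hH : MeasurableSet H) :
    idealMeasure X l H = ENNReal.ofReal (∑ i ∈ Finset.range l.length,
      if ComputableMetricSpace.ideal (l.getD i (0, 0)).1 ∈ H then
        (posRatOf (l.getD i (0, 0)).2 : ℝ) else 0) := by
  have hnn : ∀ (p : Prop) (n : ℕ), 0 ≤ if p then (posRatOf n : ℝ) else 0 := by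
    intro p n
    split_ifs
    · exact_mod_cast (posRatOf_pos n).le
    · exact le_rfl
  induction l with
  | nil => simp [idealMeasure]
  | cons p l ih =>
    have h1 : idealMeasure X (p :: l) = ENNReal.ofReal (posRatOf p.2 : ℝ) •
        Measure.dirac (ComputableMetricSpace.ideal p.1 : X) + idealMeasure X l := by
      simp [idealMeasure]
    rw [h1, Measure.add_apply, ih, List.length_cons, Finset.sum_range_succ',
      ENNReal.ofReal_add (Finset.sum_nonneg fun i _ => hnn _ _) (hnn _ _), add_comm]
    congr 1
    rw [Measure.smul_apply, Measure.dirac_apply' _ hH]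
    by_cases hp : ComputableMetricSpace.ideal p.1 ∈ H <;> simp [hp]

open Classical in
theorem idealMeasure_real (l : List (ℕ × ℕ)) {H : Set X} (hH : MeasurableSet H) :
    (idealMeasure X l).real H = ∑ i ∈ Finset.range l.length,
      if ComputableMetricSpace.ideal (l.getD i (0, 0)).1 ∈ H then
        (posRatOf (l.getD i (0, 0)).2 : ℝ) else 0 := by
  rw [measureReal_def, idealMeasure_apply l hH, ENNReal.toReal_ofReal]
  refine Finset.sum_nonneg fun i _ => ?_
  split_ifs
  · exact_mod_cast (posRatOf_pos _).le
  · exact le_rfl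

theorem measureReal_le_of_levyProkhorovEDist_lt {Ω : Type*} [PseudoEMetricSpace Ω]
    [MeasurableSpace Ω] {μ ν : Measure Ω} [IsFiniteMeasure μ]
    [IsFiniteMeasure ν] {c : ℝ} (hc : 0 ≤ c)
    (h : levyProkhorovEDist μ ν < ENNReal.ofReal c) {B : Set Ω} (hB : MeasurableSet B) :
    μ.real B ≤ ν.real (Metric.thickening c B) + c ∧
      ν.real B ≤ μ.real (Metric.thickening c B) + c := by
  have h1 := left_measure_le_of_levyProkhorovEDist_lt h hB
  have h2 := right_measure_le_of_levyProkhorovEDist_lt h hB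
  rw [ENNReal.toReal_ofReal hc] at h1 h2
  constructor
  · have := ENNReal.toReal_mono (by finiteness) h1
    rwa [ENNReal.toReal_add (by finiteness) (by finiteness), ENNReal.toReal_ofReal hc] at this
  · have := ENNReal.toReal_mono (by finiteness) h2
    rwa [ENNReal.toReal_add (by finiteness) (by finiteness), ENNReal.toReal_ofReal hc] at this

/-- The measure of a constructive open set is exhausted by its balls, slightly shrunk. -/
theorem exists_lt_measureReal_shrunk {μ : Measure X} [IsFiniteMeasure μ] {U : Set X}
    {p : ℕ → Prop} (hU : ∀ x, x ∈ U ↔ ∃ k, p k ∧ x ∈ idealBall X k) {r : ℝ} (hr : r < μ.real U) :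
    ∃ n : ℕ, r + 4 * (1 / 2 : ℝ) ^ n < μ.real
      {x | ∃ k, p k ∧ dist x (ballCenter X k) < ballRadius k - 4 * (1 / 2 : ℝ) ^ n} := by
  set G : ℕ → Set X := fun n =>
    {x | ∃ k, p k ∧ dist x (ballCenter X k) < ballRadius k - 4 * (1 / 2 : ℝ) ^ n} with hG
  have hmono : Monotone G := by
    rintro m n hmn x ⟨k, hk, hx⟩
    refine ⟨k, hk, hx.trans_le ?_⟩
    have := pow_le_pow_of_le_one (by norm_num : (0 : ℝ) ≤ 1 / 2) (by norm_num) hmn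
    linarith
  have h0 : Tendsto (fun n : ℕ => 4 * (1 / 2 : ℝ) ^ n) atTop (𝓝 0) := by
    simpa using (tendsto_pow_atTop_nhds_zero_of_lt_one (by norm_num : (0 : ℝ) ≤ 1 / 2)
      (by norm_num)).const_mul 4
  have hUG : ⋃ n, G n = U := by
    ext x
    rw [hU, Set.mem_iUnion]
    constructor
    · rintro ⟨n, k, hk, hx⟩
      refine ⟨k, hk, mem_idealBall.2 (hx.trans_le ?_)⟩
      have : (0 : ℝ) ≤ (1 / 2) ^ n := by positivity
      linarith
    · rintro ⟨k, hk, hx⟩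
      obtain ⟨n, hn⟩ := (h0.eventually_lt_const (sub_pos.2 (mem_idealBall.1 hx))).exists
      exact ⟨n, k, hk, by linarith⟩
  have h1 : Tendsto (fun n => μ.real (G n) - 4 * (1 / 2 : ℝ) ^ n) atTop (𝓝 (μ.real U)) := by
    have h2 : Tendsto (fun n => μ.real (G n)) atTop (𝓝 (μ.real U)) := by
      rw [← hUG]
      exact (ENNReal.tendsto_toReal (measure_ne_top _ _)).comp
        (tendsto_measure_iUnion_atTop hmono)
    simpa using h2.sub h0
  obtain ⟨n, hn⟩ := (h1.eventually_const_lt hr).exists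
  exact ⟨n, by linarith⟩

/-- The measure of constructive open sets is lower semicomputable. -/
theorem IsComputableMeasure.re_lt_measureReal [BorelSpace X] {μ : Measure X} [IsProbabilityMeasure μ]
    (hμ : IsComputableMeasure μ) {U : α → Set X} (hU : ConstructiveOpen U) {r : α → ℚ}
    (hr : RatComputable r) : REPred fun a => (r a : ℝ) < μ.real (U a) := by
  classical
  obtain ⟨A, hA, hAμ⟩ := hμ
  obtain ⟨p, hp, hUp⟩ := hU
  let wt : ℕ → List ℕ → ℕ → ℚ := fun n M i =>
    if (!(M.getD i 0 == 0)) = true then posRatOf ((A n).getD i (0, 0)).2 else 0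
  have hwt : ∀ n M i, wt n M i =
      if M.getD i 0 = 0 then 0 else posRatOf ((A n).getD i (0, 0)).2 := by
    intro n M i
    simp only [wt, Bool.not_eq_true', beq_eq_false_iff_ne, ne_eq, ite_not]
  -- A finite certificate for the inequality. Entry `0` of `M` discards the atom, and entry `k + 1`
  -- asserts that it lies in the ball `k` of `U a` shrunk by `2 * (1 / 2) ^ n`. This margin, also
  -- required of the mass, pays for the Prokhorov error in both space and measure.
  let Q : α → ℕ → List ℕ → Prop := fun a n M =>
      (∀ i < (A n).length, M.getD i 0 = 0 ∨ (p a (M.getD i 0 - 1) ∧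
        dist (ComputableMetricSpace.ideal ((A n).getD i (0, 0)).1 : X)
          (ComputableMetricSpace.ideal (M.getD i 0 - 1).unpair.1) <
            ((ballRadius (M.getD i 0 - 1) - 2 * (1 / 2) ^ n : ℚ) : ℝ))) ∧
      r a + 2 * (1 / 2) ^ n < ∑ i ∈ Finset.range (A n).length, wt n M i
  have hre : REPred fun x : (α × ℕ) × List ℕ => Q x.1.1 x.1.2 x.2 := by
    have cn : Computable fun x : (α × ℕ) × List ℕ => x.1.2 := Computable.snd.comp Computable.fst
    have cl : Computable fun x : (α × ℕ) × List ℕ => (A x.1.2).length :=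
      Computable.list_length.comp (hA.comp cn)
    have ca : Computable fun y : ((α × ℕ) × List ℕ) × ℕ => (A y.1.1.2).getD y.2 (0, 0) :=
      (Primrec.list_getD (0, 0)).to_comp.comp ((hA.comp cn).comp Computable.fst) Computable.snd
    have cm : Computable fun y : ((α × ℕ) × List ℕ) × ℕ => y.1.2.getD y.2 0 :=
      (Primrec.list_getD 0).to_comp.comp (Computable.snd.comp Computable.fst) Computable.snd
    have cm1 : Computable fun y : ((α × ℕ) × List ℕ) × ℕ => y.1.2.getD y.2 0 - 1 :=
      Computable.pred.comp cm
    refine REPred.and (REPred.forall_lt (p := fun (x : (α × ℕ) × List ℕ) i => x.2.getD i 0 = 0 ∨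
      (p x.1.1 (x.2.getD i 0 - 1) ∧
        dist (ComputableMetricSpace.ideal ((A x.1.2).getD i (0, 0)).1 : X)
          (ComputableMetricSpace.ideal (x.2.getD i 0 - 1).unpair.1) <
            ((ballRadius (x.2.getD i 0 - 1) - 2 * (1 / 2) ^ x.1.2 : ℚ) : ℝ))) ?_ cl) ?_
    · refine REPred.or (REPred.nat_eq cm (Computable.const 0)) (REPred.and ?_ ?_)
      · exact hp.comp (f := fun y : ((α × ℕ) × List ℕ) × ℕ => (y.1.1.1, y.1.2.getD y.2 0 - 1))
          ((Computable.fst.comp (Computable.fst.comp Computable.fst)).pair cm1)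
      · exact re_dist_ideal_lt (Computable.fst.comp ca) cm1.unpair₁
          ((RatComputable.ballRadius cm1).sub ((RatComputable.const 2).mul
            (RatComputable.pow (cn.comp Computable.fst))))
    · refine RatComputable.re_lt
        ((hr.comp (f := fun x : (α × ℕ) × List ℕ => x.1.1) (Computable.fst.comp Computable.fst)).add
          ((RatComputable.const 2).mul (RatComputable.pow cn)))
        (RatComputable.sum_range (r := fun (x : (α × ℕ) × List ℕ) i => wt x.1.2 x.2 i) ?_ cl)
      exact RatComputable.ite (Primrec.not.to_comp.comp
        (Primrec.beq.to_comp.comp cm (Computable.const 0)))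
        (RatComputable.posRatOf (Computable.snd.comp ca)) (RatComputable.const 0)
  refine (REPred.ex (p := fun a n => ∃ M, Q a n M)
    (REPred.ex (p := fun (x : α × ℕ) M => Q x.1 x.2 M) hre)).of_eq fun a => ?_
  have hLP : ∀ n, IsProbabilityMeasure (idealMeasure X (A n)) ∧
      levyProkhorovEDist (idealMeasure X (A n)) μ < ENNReal.ofReal (2 * (1 / 2) ^ n) := by
    refine fun n => ⟨(hAμ n).1, (hAμ n).2.trans_lt ?_⟩
    have : (0 : ℝ) < (1 / 2) ^ n := by positivity
    exact (ENNReal.ofReal_lt_ofReal_iff (by positivity)).2 (by linarith)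
  constructor
  · rintro ⟨n, M, hM, hsum⟩
    obtain ⟨hprob, hlp⟩ := hLP n
    have hc : (0 : ℝ) ≤ 2 * (1 / 2) ^ n := by positivity
    let E : Set X := (fun i => (ComputableMetricSpace.ideal ((A n).getD i (0, 0)).1 : X)) ''
      (((Finset.range (A n).length).filter fun i => M.getD i 0 ≠ 0 : Finset ℕ) : Set ℕ)
    have hE : MeasurableSet E := (Set.Finite.image _ (Finset.finite_toSet _)).measurableSet
    have h1 := (measureReal_le_of_levyProkhorovEDist_lt hc hlp hE).1
    have h2 : ((∑ i ∈ Finset.range (A n).length, wt n M i : ℚ) : ℝ) ≤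
        (idealMeasure X (A n)).real E := by
      rw [idealMeasure_real _ hE, Rat.cast_sum]
      refine Finset.sum_le_sum fun i hi => ?_
      by_cases hi0 : M.getD i 0 = 0
      · have : wt n M i = 0 := by rw [hwt, if_pos hi0]
        rw [this]
        split_ifs
        · exact_mod_cast (posRatOf_pos _).le
        · simp
      · have h3 : wt n M i = posRatOf ((A n).getD i (0, 0)).2 := by
          rw [hwt, if_neg hi0]
        rw [h3, if_pos]
        exact ⟨i, by simpa using ⟨Finset.mem_range.1 hi, by simpa using hi0⟩, rfl⟩
    have h3 : Metric.thickening (2 * (1 / 2) ^ n) E ⊆ U a := by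
      intro x hx
      obtain ⟨z, ⟨i, hi, rfl⟩, hxz⟩ := Metric.mem_thickening_iff.1 hx
      obtain ⟨hi1, hi2⟩ := Finset.mem_filter.1 (Finset.mem_coe.1 hi)
      obtain ⟨hp1, hp2⟩ := (hM i (Finset.mem_range.1 hi1)).resolve_left hi2
      refine (hUp a x).2 ⟨_, hp1, mem_idealBall.2 ?_⟩
      push_cast at hp2
      have := dist_triangle x (ComputableMetricSpace.ideal ((A n).getD i (0, 0)).1)
        (ballCenter X (M.getD i 0 - 1))
      unfold ballCenter at this ⊢
      linarith
    have h4 : μ.real (Metric.thickening (2 * (1 / 2) ^ n) E) ≤ μ.real (U a) := measureReal_mono h3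
    have h5 := (Rat.cast_lt (K := ℝ)).2 hsum
    push_cast at h5 h2
    linarith
  · intro hlt
    -- Shrinking by four units of `(1 / 2) ^ n` leaves two after thickening by the Prokhorov error,
    -- exactly the margin demanded by `Q`; likewise for the mass.
    obtain ⟨n, hn⟩ := exists_lt_measureReal_shrunk (hUp a) hlt
    obtain ⟨hprob, hlp⟩ := hLP n
    have hc : (0 : ℝ) ≤ 2 * (1 / 2) ^ n := by positivity
    let G : ℝ → Set X := fun s =>
      {x | ∃ k, p a k ∧ dist x (ballCenter X k) < ballRadius k - s * (1 / 2 : ℝ) ^ n}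
    have hGm : ∀ s, MeasurableSet (G s) := by
      intro s
      have : G s = ⋃ (k : ℕ) (_ : p a k),
          Metric.ball (ballCenter X k) (ballRadius k - s * (1 / 2 : ℝ) ^ n) := by
        ext x
        simp [G]
      rw [this]
      exact MeasurableSet.iUnion fun k => MeasurableSet.iUnion fun _ => Metric.isOpen_ball.measurableSet
    have h1 := (measureReal_le_of_levyProkhorovEDist_lt hc hlp (hGm 4)).2
    have h2 : Metric.thickening (2 * (1 / 2) ^ n) (G 4) ⊆ G 2 := by
      intro x hx
      obtain ⟨z, ⟨k, hk, hz⟩, hxz⟩ := Metric.mem_thickening_iff.1 hx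
      refine ⟨k, hk, ?_⟩
      have := dist_triangle x z (ballCenter X k)
      linarith
    have h3 : (idealMeasure X (A n)).real (Metric.thickening (2 * (1 / 2) ^ n) (G 4)) ≤
        (idealMeasure X (A n)).real (G 2) := measureReal_mono h2
    rw [idealMeasure_real _ (hGm 2)] at h3
    let w : ℕ → ℕ := fun i =>
      if h : ComputableMetricSpace.ideal ((A n).getD i (0, 0)).1 ∈ G 2 then h.choose + 1 else 0
    have hw : ∀ i < (A n).length, ((List.range (A n).length).map w).getD i 0 = w i := by
      intro i hi
      simp [List.getD, hi]
    refine ⟨n, (List.range (A n).length).map w, fun i hi => ?_, ?_⟩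
    · rw [hw i hi]
      by_cases h : ComputableMetricSpace.ideal ((A n).getD i (0, 0)).1 ∈ G 2
      · right
        have hwi : w i - 1 = h.choose := by simp only [w, dif_pos h]; rfl
        rw [hwi]
        refine ⟨h.choose_spec.1, ?_⟩
        have := h.choose_spec.2
        push_cast
        exact this
      · left
        simp only [w, dif_neg h]
    · refine (Rat.cast_lt (K := ℝ)).1 ?_
      have h4 : ((∑ i ∈ Finset.range (A n).length, wt n ((List.range (A n).length).map w) i : ℚ) : ℝ)
          = ∑ i ∈ Finset.range (A n).length,
            if ComputableMetricSpace.ideal ((A n).getD i (0, 0)).1 ∈ G 2 then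
            (posRatOf ((A n).getD i (0, 0)).2 : ℝ) else 0 := by
        rw [Rat.cast_sum]
        refine Finset.sum_congr rfl fun i hi => ?_
        rw [hwt, hw i (Finset.mem_range.1 hi)]
        by_cases h : ComputableMetricSpace.ideal ((A n).getD i (0, 0)).1 ∈ G 2
        · simp only [w, dif_pos h, if_pos h]
          simp
        · simp only [w, dif_neg h, if_neg h]
          simp
      rw [h4]
      push_cast
      linarith

end ComputableMeasure

/-! ### Preimages under iterates and events on Birkhoff sums -/

section Iterates

variable {X : Type*} [MetricSpace X] [ComputableMetricSpace X]
variable {α : Type*} [Primcodable α]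

/-- The iterates of a relation on codes. -/
def iterRel (v : ℕ → ℕ → Prop) : ℕ → ℕ → ℕ → Prop
  | 0, l, k => l = k
  | j + 1, l, k => ∃ k', iterRel v j l k' ∧ v k' k

theorem iterRel_iff_exists_seq {v : ℕ → ℕ → Prop} {j l k : ℕ} :
    iterRel v j l k ↔ ∃ s : ℕ → ℕ, s 0 = l ∧ s j = k ∧ ∀ i < j, v (s i) (s (i + 1)) := by
  induction j generalizing k with
  | zero =>
    constructor
    · rintro rfl
      exact ⟨fun _ => l, rfl, rfl, by simp⟩
    · rintro ⟨s, rfl, rfl, -⟩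
      rfl
  | succ j ih =>
    constructor
    · rintro ⟨k', hk', hv⟩
      obtain ⟨s, h0, hj, hs⟩ := ih.1 hk'
      refine ⟨fun i => if i ≤ j then s i else k, by simp [h0], by simp, fun i hi => ?_⟩
      rcases Nat.lt_succ_iff_lt_or_eq.1 hi with h | rfl
      · have h1 : i ≤ j := h.le
        have h2 : i + 1 ≤ j := h
        simp only [if_pos h1, if_pos h2]
        exact hs i h
      · simpa [hj] using hv
    · rintro ⟨s, h0, hj, hs⟩
      exact ⟨s j, ih.2 ⟨s, h0, rfl, fun i hi => hs i (by omega)⟩, hj ▸ hs j (by omega)⟩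

/-- A path of length `j` is a finite list of codes, so one searches for the list and verifies its
finitely many links. -/
theorem re_iterRel {v : ℕ → ℕ → Prop} (hv : REPred fun x : ℕ × ℕ => v x.1 x.2) :
    REPred fun x : (ℕ × ℕ) × ℕ => iterRel v x.1.1 x.1.2 x.2 := by
  have h : REPred fun y : ((ℕ × ℕ) × ℕ) × List ℕ => (y.2.getD 0 0 = y.1.1.2 ∧
      y.2.getD y.1.1.1 0 = y.1.2) ∧ ∀ i < y.1.1.1, v (y.2.getD i 0) (y.2.getD (i + 1) 0) := by
    have g : Computable₂ fun (L : List ℕ) (n : ℕ) => L.getD n 0 := (Primrec.list_getD 0).to_comp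
    have cj : Computable fun y : ((ℕ × ℕ) × ℕ) × List ℕ => y.1.1.1 :=
      Computable.fst.comp (Computable.fst.comp Computable.fst)
    refine REPred.and (REPred.and ?_ ?_) (REPred.forall_lt
      (p := fun (y : ((ℕ × ℕ) × ℕ) × List ℕ) i => v (y.2.getD i 0) (y.2.getD (i + 1) 0)) ?_ cj)
    · exact REPred.nat_eq (g.comp Computable.snd (Computable.const 0))
        (Computable.snd.comp (Computable.fst.comp Computable.fst))
    · exact REPred.nat_eq (g.comp Computable.snd cj) (Computable.snd.comp Computable.fst)
    · exact hv.comp (f := fun z : (((ℕ × ℕ) × ℕ) × List ℕ) × ℕ =>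
          (z.1.2.getD z.2 0, z.1.2.getD (z.2 + 1) 0))
        ((g.comp (Computable.snd.comp Computable.fst) Computable.snd).pair
          (g.comp (Computable.snd.comp Computable.fst) (Computable.succ.comp Computable.snd)))
  refine (REPred.ex (p := fun (x : (ℕ × ℕ) × ℕ) (L : List ℕ) => (L.getD 0 0 = x.1.2 ∧
      L.getD x.1.1 0 = x.2) ∧ ∀ i < x.1.1, v (L.getD i 0) (L.getD (i + 1) 0)) h).of_eq ?_
  rintro ⟨⟨j, l⟩, k⟩
  rw [iterRel_iff_exists_seq]
  constructor
  · rintro ⟨L, ⟨h0, hj⟩, hs⟩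
    exact ⟨fun i => L.getD i 0, h0, hj, hs⟩
  · rintro ⟨s, h0, hj, hs⟩
    have hL : ∀ i ≤ j, ((List.range (j + 1)).map s).getD i 0 = s i := by
      intro i hi
      simp [List.getD, Nat.lt_succ_iff.2 hi]
    refine ⟨(List.range (j + 1)).map s, ⟨?_, ?_⟩, fun i hi => ?_⟩
    · rw [hL 0 (Nat.zero_le _)]; exact h0
    · dsimp only; rw [hL j le_rfl]; exact hj
    · dsimp only at hi
      rw [hL i hi.le, hL (i + 1) hi]
      exact hs i hi

theorem IsConstructiveGδ.inter {D E : Set X} (hD : IsConstructiveGδ D) (hE : IsConstructiveGδ E) :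
    IsConstructiveGδ (D ∩ E) := by
  obtain ⟨U, hU, rfl⟩ := hD
  obtain ⟨V, hV, rfl⟩ := hE
  exact ⟨fun n => U n ∩ V n, uniformlyConstructiveOpen_iff.2
    ((uniformlyConstructiveOpen_iff.1 hU).inter (uniformlyConstructiveOpen_iff.1 hV)),
    by ext x; simp [forall_and]⟩

/-- The orbitwise core of a constructive `G_δ`-set on which `T` is computable: it is forward
invariant, it contains every point whose whole orbit stays in the set, and on it preimages of
constructive open sets under the iterates of `T` are constructive open. -/
theorem IsComputableOn.exists_invariant_core {T : X → X} {D : Set X} (hD : IsConstructiveGδ D)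
    (hT : IsComputableOn T D) :
    ∃ D' : Set X, IsConstructiveGδ D' ∧ D' ⊆ D ∧ (∀ x ∈ D', T x ∈ D') ∧
      (⋂ j, T^[j] ⁻¹' D) ⊆ D' ∧
      ∀ U : ℕ → Set X, ConstructiveOpen U → ∃ V : ℕ × ℕ → Set X, ConstructiveOpen V ∧
        ∀ j i, ∀ x ∈ D', x ∈ V (j, i) ↔ T^[j] x ∈ U i := by
  obtain ⟨V, hV, hTV⟩ := hT
  obtain ⟨v, hv, hVv⟩ := uniformlyConstructiveOpen_iff.1 hV
  have hTv : ∀ l, ∀ x ∈ D, T x ∈ idealBall X l ↔ ∃ k, v l k ∧ x ∈ idealBall X k := by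
    intro l x hx
    have := Set.ext_iff.1 (hTV l) x
    simp only [Set.mem_inter_iff, Set.mem_preimage, hx, and_true] at this
    rw [this, hVv]
  -- Formal pullback: `j` times over, every ball is replaced by balls enumerated for its preimage.
  -- It is open everywhere but agrees with the true preimage only along orbits that stay in `D`.
  let W : (ℕ → ℕ → Prop) → ℕ → ℕ → Set X := fun p j i =>
    {x | ∃ k, (∃ l, p i l ∧ iterRel v j l k) ∧ x ∈ idealBall X k}
  have hW : ∀ p : ℕ → ℕ → Prop, REPred (fun x : ℕ × ℕ => p x.1 x.2) →
      ConstructiveOpen fun x : ℕ × ℕ => W p x.1 x.2 := by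
    intro p hp
    refine ⟨fun x k => ∃ l, p x.2 l ∧ iterRel v x.1 l k, ?_, fun a x => Iff.rfl⟩
    refine REPred.ex (p := fun (x : (ℕ × ℕ) × ℕ) l => p x.1.2 l ∧ iterRel v x.1.1 l x.2) ?_
    have c1 : Computable fun z : ((ℕ × ℕ) × ℕ) × ℕ => z.1.1.1 :=
      Computable.fst.comp (Computable.fst.comp Computable.fst)
    have c2 : Computable fun z : ((ℕ × ℕ) × ℕ) × ℕ => z.1.1.2 :=
      Computable.snd.comp (Computable.fst.comp Computable.fst)
    have c3 : Computable fun z : ((ℕ × ℕ) × ℕ) × ℕ => z.1.2 :=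
      Computable.snd.comp Computable.fst
    exact REPred.and
      (hp.comp (f := fun z : ((ℕ × ℕ) × ℕ) × ℕ => (z.1.1.2, z.2)) (c2.pair Computable.snd))
      ((re_iterRel hv).comp (f := fun z : ((ℕ × ℕ) × ℕ) × ℕ => ((z.1.1.1, z.2), z.1.2))
        ((c1.pair Computable.snd).pair c3))
  have hW0 : ∀ p i x, x ∈ W p 0 i ↔ ∃ k, p i k ∧ x ∈ idealBall X k := by
    intro p i x
    constructor
    · rintro ⟨k, ⟨l, hl, rfl⟩, hx⟩
      exact ⟨l, hl, hx⟩
    · rintro ⟨k, hk, hx⟩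
      exact ⟨k, ⟨k, hk, rfl⟩, hx⟩
  have hWs : ∀ p j i, ∀ x ∈ D, x ∈ W p (j + 1) i ↔ T x ∈ W p j i := by
    intro p j i x hx
    constructor
    · rintro ⟨k, ⟨l, hl, k', hk', hv'⟩, hxk⟩
      exact ⟨k', ⟨l, hl, hk'⟩, (hTv k' x hx).2 ⟨k, hv', hxk⟩⟩
    · rintro ⟨k', ⟨l, hl, hk'⟩, hxk⟩
      obtain ⟨k, hv', hxk'⟩ := (hTv k' x hx).1 hxk
      exact ⟨k, ⟨l, hl, k', hk', hv'⟩, hxk'⟩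
  obtain ⟨UD, hUD, rfl⟩ := hD
  obtain ⟨d, hd, hUd⟩ := uniformlyConstructiveOpen_iff.1 hUD
  have hsub : ∀ x, (∀ m : ℕ, x ∈ W d m.unpair.1 m.unpair.2) → ∀ j i, x ∈ W d j i := by
    intro x hx j i
    simpa using hx (Nat.pair j i)
  have hD'D : (⋂ m : ℕ, W d m.unpair.1 m.unpair.2) ⊆ ⋂ n, UD n := by
    intro x hx
    refine Set.mem_iInter.2 fun n => (hUd n x).2 ((hW0 d n x).1 ?_)
    exact hsub x (Set.mem_iInter.1 hx) 0 n
  have hinv : ∀ x ∈ ⋂ m : ℕ, W d m.unpair.1 m.unpair.2,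
      T x ∈ ⋂ m : ℕ, W d m.unpair.1 m.unpair.2 := fun x hx =>
    Set.mem_iInter.2 fun m => (hWs d _ _ x (hD'D hx)).1 (hsub x (Set.mem_iInter.1 hx) _ _)
  -- The core imposes all formal pullbacks of the open sets defining `D`. It is invariant because
  -- level `j + 1` at `x` is level `j` at `T x`, and it is a `G_δ`-set because no true preimage
  -- occurs in its definition.
  refine ⟨⋂ m : ℕ, W d m.unpair.1 m.unpair.2, ⟨_, uniformlyConstructiveOpen_iff.2
    ((hW d hd).comp Computable.unpair), rfl⟩, hD'D, hinv, ?_, ?_⟩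
  · intro x hx
    have key : ∀ j i x, x ∈ (⋂ j, T^[j] ⁻¹' ⋂ n, UD n) → x ∈ W d j i := by
      intro j i
      induction j with
      | zero =>
        intro x hx
        exact (hW0 d i x).2 ((hUd i x).1 (Set.mem_iInter.1 (Set.mem_iInter.1 hx 0) i))
      | succ j ih =>
        intro x hx
        refine (hWs d j i x (Set.mem_iInter.1 hx 0)).2 (ih _ (Set.mem_iInter.2 fun n => ?_))
        exact Set.mem_iInter.1 hx (n + 1)
    exact Set.mem_iInter.2 fun m => key _ _ x hx
  · rintro U ⟨p, hp, hUp⟩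
    refine ⟨fun x => W p x.1 x.2, hW p hp, fun j i => ?_⟩
    induction j with
    | zero => exact fun x _ => (hW0 p i x).trans (hUp i x).symm
    | succ j ih => exact fun x hx => (hWs p j i x (hD'D hx)).trans (ih _ (hinv x hx))

/-- Birkhoff sums of a computable observable: the set where the sum is close to a prescribed
rational is constructive open, relative to a set on which the orbit is controlled. -/
theorem exists_constructiveOpen_birkhoffSum {T : X → X} {φ : X → ℝ} {D : Set X}
    {V : ℕ × ℕ → Set X} (hV : ConstructiveOpen V)
    (hφV : ∀ j i, ∀ x ∈ D, x ∈ V (j, i) ↔ φ (T^[j] x) ∈ idealBall ℝ i)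
    {n : α → ℕ} (hn : Computable n) {q δ : α → ℚ} (hq : RatComputable q)
    (hδ : RatComputable δ) :
    ∃ W : α → Set X, ConstructiveOpen W ∧ ∀ a, ∀ x ∈ D,
      x ∈ W a ↔ |birkhoffSum T φ (n a) x - n a * q a| < n a * δ a := by
  let s : α → List ℕ → ℚ := fun a L => ∑ j ∈ Finset.range (n a), ratOf (L.getD j 0).unpair.1
  let t : α → List ℕ → ℚ := fun a L => ∑ j ∈ Finset.range (n a), posRatOf (L.getD j 0).unpair.2
  -- The list `L` encloses each value along the orbit in a rational ball. Summing centres and radii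
  -- encloses the Birkhoff sum, and `Q` requires that enclosure to fit strictly inside the target
  -- interval.
  let Q : α → List ℕ → Prop := fun a L =>
    s a L - n a * q a + t a L < n a * δ a ∧ -(s a L - n a * q a) + t a L < n a * δ a
  have g : Computable₂ fun (L : List ℕ) (n : ℕ) => L.getD n 0 := (Primrec.list_getD 0).to_comp
  have hQ : REPred fun x : α × List ℕ => Q x.1 x.2 := by
    have c1 : Computable fun x : α × List ℕ => n x.1 := hn.comp Computable.fst
    have c2 : Computable fun y : (α × List ℕ) × ℕ => y.1.2.getD y.2 0 :=
      g.comp (Computable.snd.comp Computable.fst) Computable.snd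
    have hs : RatComputable fun x : α × List ℕ => s x.1 x.2 :=
      RatComputable.sum_range (r := fun (x : α × List ℕ) j => ratOf (x.2.getD j 0).unpair.1)
        (RatComputable.ratOf c2.unpair₁) c1
    have ht : RatComputable fun x : α × List ℕ => t x.1 x.2 :=
      RatComputable.sum_range (r := fun (x : α × List ℕ) j => posRatOf (x.2.getD j 0).unpair.2)
        (RatComputable.posRatOf c2.unpair₂) c1
    have hd := hs.sub ((RatComputable.natCast c1).mul (hq.comp Computable.fst))
    have he := (RatComputable.natCast c1).mul (hδ.comp (f := fun x : α × List ℕ => x.1)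
      Computable.fst)
    exact (RatComputable.re_lt (hd.add ht) he).and (RatComputable.re_lt (hd.neg.add ht) he)
  refine ⟨fun a => ⋃ L : List ℕ, {x | Q a L ∧ x ∈ {x | ∀ j < n a, x ∈ V (j, L.getD j 0)}},
    ConstructiveOpen.iUnion (U := fun a (L : List ℕ) =>
      {x | Q a L ∧ x ∈ {x | ∀ j < n a, x ∈ V (j, L.getD j 0)}})
    (ConstructiveOpen.guard (ConstructiveOpen.iInter_lt
      (U := fun (x : α × List ℕ) j => V (j, x.2.getD j 0)) ?_ (hn.comp Computable.fst)) hQ),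
    fun a x hx => ?_⟩
  · exact hV.comp (f := fun y : (α × List ℕ) × ℕ => (y.2, y.1.2.getD y.2 0))
      (Computable.snd.pair (g.comp (Computable.snd.comp Computable.fst) Computable.snd))
  simp only [Set.mem_iUnion, Set.mem_ofPred_eq]
  constructor
  · rintro ⟨L, ⟨h1, h2⟩, h3⟩
    have h4 : |birkhoffSum T φ (n a) x - (s a L : ℝ)| ≤ t a L := by
      simp only [birkhoffSum, s, t, Rat.cast_sum, ← Finset.sum_sub_distrib]
      refine (Finset.abs_sum_le_sum_abs _ _).trans (Finset.sum_le_sum fun j hj => ?_)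
      have := (hφV j _ x hx).1 (h3 j (Finset.mem_range.1 hj))
      exact (show dist (φ (T^[j] x)) _ < _ from this).le
    have h1' := (Rat.cast_lt (K := ℝ)).2 h1
    have h2' := (Rat.cast_lt (K := ℝ)).2 h2
    push_cast at h1' h2'
    rw [abs_le] at h4
    rw [abs_lt]
    constructor <;> linarith [h4.1, h4.2]
  · intro h
    have hn0 : 0 < (n a : ℝ) := by
      rcases Nat.eq_zero_or_pos (n a) with h0 | h0
      · simp [h0] at h
      · exact_mod_cast h0
    set gap : ℝ := n a * δ a - |birkhoffSum T φ (n a) x - n a * q a| with hgap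
    have hgap0 : 0 < gap := sub_pos.2 h
    -- Radii of this size add up to less than `gap / 2`; the total radius is paid twice, for
    -- locating the sum and for the width of the enclosure.
    have hε : 0 < gap / (2 * n a) := by positivity
    have hb : ∀ j : ℕ, ∃ i, φ (T^[j] x) ∈ idealBall ℝ i ∧ (ballRadius i : ℝ) < gap / (2 * n a) := by
      intro j
      obtain ⟨k, hk, -, hk'⟩ := exists_idealBall_formalIncl (φ (T^[j] x)) ∅ (by simp) hε
      exact ⟨k, hk, hk'⟩
    choose b hb1 hb2 using hb
    have hL : ∀ i < n a, ((List.range (n a)).map b).getD i 0 = b i := by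
      intro i hi
      simp [List.getD, hi]
    have hs : s a ((List.range (n a)).map b) = ∑ j ∈ Finset.range (n a), ratOf (b j).unpair.1 :=
      Finset.sum_congr rfl fun j hj => by rw [hL j (Finset.mem_range.1 hj)]
    have ht : t a ((List.range (n a)).map b) = ∑ j ∈ Finset.range (n a), ballRadius (b j) :=
      Finset.sum_congr rfl fun j hj => by rw [hL j (Finset.mem_range.1 hj)]; rfl
    have h4 : |birkhoffSum T φ (n a) x - (s a ((List.range (n a)).map b) : ℝ)| ≤
        t a ((List.range (n a)).map b) := by
      rw [hs, ht]
      simp only [birkhoffSum, Rat.cast_sum, ← Finset.sum_sub_distrib]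
      refine (Finset.abs_sum_le_sum_abs _ _).trans (Finset.sum_le_sum fun j hj => ?_)
      exact (show dist (φ (T^[j] x)) _ < _ from hb1 j).le
    have h5 : (t a ((List.range (n a)).map b) : ℝ) < gap / 2 := by
      rw [ht, Rat.cast_sum]
      calc ∑ j ∈ Finset.range (n a), (ballRadius (b j) : ℝ)
          < ∑ j ∈ Finset.range (n a), gap / (2 * n a) :=
            Finset.sum_lt_sum_of_nonempty
              (Finset.nonempty_range_iff.2 (by rintro h0; simp [h0] at hn0)) fun j _ => hb2 j
        _ = gap / 2 := by
            rw [Finset.sum_const, Finset.card_range, nsmul_eq_mul]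
            field_simp
    refine ⟨(List.range (n a)).map b, ⟨?_, ?_⟩, fun j hj => ?_⟩
    · refine (Rat.cast_lt (K := ℝ)).1 ?_
      push_cast
      have := le_abs_self (birkhoffSum T φ (n a) x - n a * q a)
      have := (abs_le.1 h4).1
      linarith
    · refine (Rat.cast_lt (K := ℝ)).1 ?_
      push_cast
      have := neg_abs_le (birkhoffSum T φ (n a) x - n a * q a)
      have := (abs_le.1 h4).2
      linarith
    · rw [hL j hj]
      exact (hφV j _ x hx).2 (hb1 j)

end Iterates

/-! ### Second moments and deviation estimates -/

section Ergodic

/-- Split the indices at `√n`. Below it the linear bound is at most `K * √n`, which is `O(n / ln²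
n)`; above it `ln p ≥ ln n / 2`, which costs a factor `4`. Thus each of the `n` terms is `O(n / ln²
n)`. -/
theorem sum_le_of_le_div_log_sq {f : ℕ → ℝ} {K c : ℝ} (hK : 0 ≤ K) (hc : 0 ≤ c)
    (h1 : ∀ p, f p ≤ K * p) (h2 : ∀ p : ℕ, 2 ≤ p → f p ≤ c * p / Real.log p ^ 2) {n : ℕ}
    (hn : 2 ≤ n) :
    ∑ p ∈ Finset.range n, f (p + 1) ≤ (16 * K + 4 * c) * (n ^ 2 / Real.log n ^ 2) := by
  have hn' : (2 : ℝ) ≤ n := by exact_mod_cast hn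
  have hlog : 0 < Real.log n := Real.log_pos (by linarith)
  have hs : 0 < √(n : ℝ) := Real.sqrt_pos.2 (by linarith)
  have hl2 : Real.log n ^ 2 ≤ 16 * √(n : ℝ) := by
    have e1 : Real.log n = 4 * Real.log √√(n : ℝ) := by
      rw [Real.log_sqrt hs.le, Real.log_sqrt (by linarith)]
      ring
    have e2 : Real.log √√(n : ℝ) ≤ √√(n : ℝ) := Real.log_le_self (Real.sqrt_nonneg _)
    have e3 : √√(n : ℝ) ^ 2 = √(n : ℝ) := Real.sq_sqrt hs.le
    have : Real.log n ≤ 4 * √√(n : ℝ) := by linarith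
    calc Real.log n ^ 2 ≤ (4 * √√(n : ℝ)) ^ 2 := by gcongr
      _ = 16 * √(n : ℝ) := by rw [mul_pow, e3]; norm_num
  have hsq : √(n : ℝ) ≤ 16 * (n / Real.log n ^ 2) := by
    rw [mul_div_assoc', le_div_iff₀ (by positivity)]
    calc √(n : ℝ) * Real.log n ^ 2 ≤ √(n : ℝ) * (16 * √(n : ℝ)) := by gcongr
      _ = 16 * n := by
        have := Real.mul_self_sqrt (by linarith : (0 : ℝ) ≤ n)
        linear_combination 16 * this
  have hp : ∀ p ∈ Finset.range n, f (p + 1) ≤ (16 * K + 4 * c) * (n / Real.log n ^ 2) := by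
    intro p hp
    have hpn : ((p + 1 : ℕ) : ℝ) ≤ n := by exact_mod_cast Finset.mem_range.1 hp
    have hA : 0 ≤ (n : ℝ) / Real.log n ^ 2 := by positivity
    rcases le_or_gt ((p + 1 : ℕ) : ℝ) √(n : ℝ) with h | h
    · calc f (p + 1) ≤ K * (p + 1 : ℕ) := h1 _
        _ ≤ K * (16 * (n / Real.log n ^ 2)) := by gcongr; exact h.trans hsq
        _ ≤ (16 * K + 4 * c) * (n / Real.log n ^ 2) := by nlinarith [mul_nonneg hc hA]
    · have h3 : (1 : ℝ) < (p + 1 : ℕ) :=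
        (Real.lt_sqrt_of_sq_lt (by linarith : (1 : ℝ) ^ 2 < n)).trans h
      have h4 : 2 ≤ p + 1 := by exact_mod_cast h3
      have h5 : Real.log n / 2 ≤ Real.log (p + 1 : ℕ) := by
        rw [← Real.log_sqrt (by linarith)]
        exact Real.log_le_log hs h.le
      calc f (p + 1) ≤ c * (p + 1 : ℕ) / Real.log (p + 1 : ℕ) ^ 2 := h2 _ h4
        _ ≤ c * n / (Real.log n / 2) ^ 2 := by gcongr
        _ = 4 * c * (n / Real.log n ^ 2) := by field_simp; norm_num
        _ ≤ (16 * K + 4 * c) * (n / Real.log n ^ 2) := by nlinarith [mul_nonneg hK hA]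
  calc ∑ p ∈ Finset.range n, f (p + 1)
      ≤ ∑ p ∈ Finset.range n, (16 * K + 4 * c) * (n / Real.log n ^ 2) := Finset.sum_le_sum hp
    _ = (16 * K + 4 * c) * (n ^ 2 / Real.log n ^ 2) := by
      rw [Finset.sum_const, Finset.card_range, nsmul_eq_mul]
      ring

variable {X : Type*} [MeasurableSpace X] {μ : Measure X} [IsProbabilityMeasure μ] {T : X → X}

theorem integrable_of_bounded {g : X → ℝ} (hg : Measurable g) {M : ℝ} (hM : ∀ x, |g x| ≤ M) :
    Integrable g μ :=
  Integrable.of_bound hg.aestronglyMeasurable M (Eventually.of_forall hM)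

/-- The second moment of a Birkhoff sum is controlled by the partial sums of correlations. -/
theorem integral_birkhoffSum_sq_le (hT : MeasurePreserving T μ μ) {g : X → ℝ} (hg : Measurable g)
    {M : ℝ} (hM : ∀ x, |g x| ≤ M) (n : ℕ) :
    ∫ x, birkhoffSum T g n x ^ 2 ∂μ ≤
      2 * ∑ p ∈ Finset.range n, ∑ k ∈ Finset.range (p + 1), ∫ x, g (T^[k] x) * g x ∂μ := by
  have hgT : ∀ k, Measurable fun x => g (T^[k] x) := fun k => hg.comp (hT.measurable.iterate k)
  have hgM : ∀ k x, |g (T^[k] x)| ≤ M := fun k x => hM _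
  have hprod : ∀ i j, Integrable (fun x => g (T^[i] x) * g (T^[j] x)) μ := fun i j =>
    integrable_of_bounded ((hgT i).mul (hgT j)) (M := M * M) fun x => by
      rw [abs_mul]
      exact mul_le_mul (hM _) (hM _) (abs_nonneg _) ((abs_nonneg _).trans (hM x))
  have hcorr : ∀ i j, ∫ x, g (T^[i] (T^[j] x)) * g (T^[j] x) ∂μ = ∫ x, g (T^[i] x) * g x ∂μ := by
    intro i j
    have h1 := (hT.iterate j).map_eq
    have h2 : AEStronglyMeasurable (fun x => g (T^[i] x) * g x) (Measure.map T^[j] μ) :=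
      ((hgT i).mul hg).aestronglyMeasurable
    rw [← integral_map (hT.measurable.iterate j).aemeasurable h2, h1]
  induction n with
  | zero => simp
  | succ n ih =>
    have hS : Measurable fun x => birkhoffSum T g n x :=
      Finset.measurable_sum _ fun k _ => hgT k
    have hSM : ∀ x, |birkhoffSum T g n x| ≤ n * M := fun x => by
      refine (Finset.abs_sum_le_sum_abs _ _).trans ((Finset.sum_le_sum fun k _ => hgM k x).trans ?_)
      simp
    have i1 : Integrable (fun x => birkhoffSum T g n x ^ 2) μ :=
      integrable_of_bounded (hS.pow_const 2) (M := (n * M) ^ 2) fun x => by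
        rw [abs_pow]
        exact pow_le_pow_left₀ (abs_nonneg _) (hSM x) 2
    -- By invariance the new cross terms are the correlations at lags `n - i`. The right side counts
    -- the diagonal term twice, and this nonnegative surplus is why the result is an inequality.
    have e : ∀ x, birkhoffSum T g (n + 1) x ^ 2 = birkhoffSum T g n x ^ 2 +
        (2 * ∑ i ∈ Finset.range n, g (T^[n] x) * g (T^[i] x) + g (T^[n] x) * g (T^[n] x)) := by
      intro x
      rw [birkhoffSum_succ, ← Finset.mul_sum]
      simp only [birkhoffSum]
      ring
    have i2 : Integrable (fun x => 2 * ∑ i ∈ Finset.range n, g (T^[n] x) * g (T^[i] x)) μ :=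
      (integrable_finsetSum _ fun i _ => hprod n i).const_mul 2
    have hd : ∀ i ≤ n, ∫ x, g (T^[n] x) * g (T^[i] x) ∂μ = ∫ x, g (T^[n - i] x) * g x ∂μ := by
      intro i hi
      rw [← hcorr (n - i) i]
      refine integral_congr_ae (Eventually.of_forall fun x => ?_)
      dsimp only
      rw [← Function.iterate_add_apply, Nat.sub_add_cancel hi]
    have hsum : ∑ k ∈ Finset.range (n + 1), ∫ x, g (T^[k] x) * g x ∂μ =
        ∑ i ∈ Finset.range n, ∫ x, g (T^[n - i] x) * g x ∂μ + ∫ x, g x * g x ∂μ := by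
      rw [← Finset.sum_range_reflect (fun k => ∫ x, g (T^[k] x) * g x ∂μ) (n + 1),
        Finset.sum_range_succ]
      simp
    have h0 : 0 ≤ ∫ x, g x * g x ∂μ := integral_nonneg fun x => mul_self_nonneg _
    have hnn := hd n le_rfl
    rw [Nat.sub_self] at hnn
    simp only [Function.iterate_zero, id] at hnn
    rw [Finset.sum_range_succ, mul_add, hsum]
    simp only [e]
    have i3 : Integrable (fun x => 2 * ∑ i ∈ Finset.range n, g (T^[n] x) * g (T^[i] x) +
        g (T^[n] x) * g (T^[n] x)) μ := i2.add (hprod n n)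
    rw [integral_add i1 i3, integral_add i2 (hprod n n), integral_const_mul,
      integral_finsetSum _ fun i _ => hprod n i, hnn,
      Finset.sum_congr rfl fun i hi => hd i (Finset.mem_range.1 hi).le]
    linarith

/-- Deviation estimate for Birkhoff sums under `ln²`-decay of the averaged correlations. -/
theorem exists_deviation_bound (hT : MeasurePreserving T μ μ) {φ : X → ℝ} (hφ : Measurable φ)
    {M : ℝ} (hM : ∀ x, |φ x| ≤ M) {c : ℝ} (hc : 0 < c)
    (h : ∀ n : ℕ, 2 ≤ n →
      |(1 / (n : ℝ)) * ∑ i ∈ Finset.range n, ∫ x, φ (T^[i] x) * φ x ∂μ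
        - (∫ x, φ x ∂μ) * (∫ x, φ x ∂μ)| ≤ c / (Real.log n) ^ 2) :
    ∃ C : ℝ, 0 ≤ C ∧ ∀ n : ℕ, 2 ≤ n → ∀ δ : ℝ, 0 < δ →
      μ.real {x | n * δ ≤ |birkhoffSum T φ n x - n * ∫ y, φ y ∂μ|} ≤
        C / (δ ^ 2 * Real.log n ^ 2) := by
  set m : ℝ := ∫ y, φ y ∂μ with hm
  have hφi : Integrable φ μ := integrable_of_bounded hφ hM
  let g : X → ℝ := fun x => φ x - m
  have hg : Measurable g := hφ.sub_const m
  have hgM : ∀ x, |g x| ≤ M + |m| := fun x => (abs_sub _ _).trans (by gcongr; exact hM x)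
  have hM0 : 0 ≤ M + |m| := by
    obtain ⟨x⟩ : Nonempty X := μ.nonempty_of_neZero
    exact (abs_nonneg _).trans (hgM x)
  have hφT : ∀ k, Integrable (fun x => φ (T^[k] x)) μ := fun k =>
    integrable_of_bounded (hφ.comp (hT.measurable.iterate k)) fun x => hM _
  have hcorr : ∀ k, ∫ x, g (T^[k] x) * g x ∂μ = ∫ x, φ (T^[k] x) * φ x ∂μ - m * m := by
    intro k
    have e : ∀ x, g (T^[k] x) * g x =
        φ (T^[k] x) * φ x - (m * φ (T^[k] x) + (m * φ x - m * m)) := fun x => by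
      simp only [g]
      ring
    have i1 : Integrable (fun x => φ (T^[k] x) * φ x) μ :=
      integrable_of_bounded ((hφ.comp (hT.measurable.iterate k)).mul hφ) (M := M * M) fun x => by
        rw [abs_mul]
        exact mul_le_mul (hM _) (hM _) (abs_nonneg _) ((abs_nonneg _).trans (hM x))
    have i2 : ∫ x, φ (T^[k] x) ∂μ = m := by
      rw [hm, ← integral_map (hT.measurable.iterate k).aemeasurable hφ.aestronglyMeasurable,
        (hT.iterate k).map_eq]
    have i3 : Integrable (fun x => m * φ x - m * m) μ :=
      (hφi.const_mul m).sub (integrable_const _)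
    have i4 : Integrable (fun x => m * φ (T^[k] x) + (m * φ x - m * m)) μ :=
      ((hφT k).const_mul m).add i3
    simp only [e]
    rw [integral_sub i1 i4, integral_add ((hφT k).const_mul m) i3,
      integral_sub (hφi.const_mul m) (integrable_const _), integral_const_mul, integral_const_mul,
      i2, integral_const]
    simp [← hm]
  have hK : ∀ p : ℕ, ∑ k ∈ Finset.range p, ∫ x, g (T^[k] x) * g x ∂μ ≤ (M + |m|) ^ 2 * p := by
    intro p
    have h1 : ∀ k, ∫ x, g (T^[k] x) * g x ∂μ ≤ (M + |m|) ^ 2 := by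
      intro k
      have hb : ∀ x, |g (T^[k] x) * g x| ≤ (M + |m|) ^ 2 := fun x => by
        rw [abs_mul, sq]
        exact mul_le_mul (hgM _) (hgM _) (abs_nonneg _) hM0
      have := integral_mono (μ := μ) (integrable_of_bounded
        ((hg.comp (hT.measurable.iterate k)).mul hg) hb) (integrable_const ((M + |m|) ^ 2))
        fun x => (le_abs_self _).trans (hb x)
      simpa using this
    calc _ ≤ ∑ k ∈ Finset.range p, (M + |m|) ^ 2 := Finset.sum_le_sum fun k _ => h1 k
      _ = _ := by rw [Finset.sum_const, Finset.card_range, nsmul_eq_mul, mul_comm]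
  have hlog : ∀ p : ℕ, 2 ≤ p →
      ∑ k ∈ Finset.range p, ∫ x, g (T^[k] x) * g x ∂μ ≤ c * p / Real.log p ^ 2 := by
    intro p hp
    have hp0 : (0 : ℝ) < p := by
      have : (2 : ℝ) ≤ p := by exact_mod_cast hp
      linarith
    simp only [hcorr]
    rw [Finset.sum_sub_distrib, Finset.sum_const, Finset.card_range, nsmul_eq_mul]
    have h1 := mul_le_mul_of_nonneg_left ((le_abs_self _).trans (h p hp)) hp0.le
    rw [mul_sub, ← mul_assoc, mul_one_div_cancel hp0.ne', one_mul] at h1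
    calc _ ≤ p * (c / Real.log p ^ 2) := h1
      _ = _ := by ring
  -- The `2` comes from the second moment expansion, the rest from `sum_le_of_le_div_log_sq` with `K
  -- = (M + |m|) ^ 2`.
  refine ⟨2 * (16 * (M + |m|) ^ 2 + 4 * c), by positivity, fun n hn δ hδ => ?_⟩
  have hn0 : (2 : ℝ) ≤ n := by exact_mod_cast hn
  have hlogn : 0 < Real.log n := Real.log_pos (by linarith)
  have hV := (integral_birkhoffSum_sq_le hT hg hgM n).trans
    (mul_le_mul_of_nonneg_left (sum_le_of_le_div_log_sq (sq_nonneg _) hc.le hK hlog hn) two_pos.le)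
  have hbs : ∀ x, birkhoffSum T φ n x - n * m = birkhoffSum T g n x := by
    intro x
    simp only [birkhoffSum, g, Finset.sum_sub_distrib, Finset.sum_const, Finset.card_range,
      nsmul_eq_mul]
  have hSm : Measurable fun x => birkhoffSum T g n x :=
    Finset.measurable_sum _ fun k _ => hg.comp (hT.measurable.iterate k)
  have hSM : ∀ x, |birkhoffSum T g n x| ≤ n * (M + |m|) := fun x => by
    refine (Finset.abs_sum_le_sum_abs _ _).trans ((Finset.sum_le_sum fun k _ => hgM _).trans ?_)
    rw [Finset.sum_const, Finset.card_range, nsmul_eq_mul]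
  have hint : Integrable (fun x => birkhoffSum T g n x ^ 2) μ :=
    integrable_of_bounded (hSm.pow_const 2) (M := (n * (M + |m|)) ^ 2) fun x => by
      rw [abs_pow]
      exact pow_le_pow_left₀ (abs_nonneg _) (hSM x) 2
  have hcheb := mul_meas_ge_le_integral_of_nonneg
    (Eventually.of_forall fun x => sq_nonneg (birkhoffSum T g n x)) hint ((n * δ) ^ 2)
  have hset : {x | (n * δ) ^ 2 ≤ birkhoffSum T g n x ^ 2} =
      {x | n * δ ≤ |birkhoffSum T φ n x - n * m|} := by
    ext x
    simp only [Set.mem_ofPred_eq]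
    rw [hbs, sq_le_sq, abs_of_nonneg (by positivity : 0 ≤ (n : ℝ) * δ)]
  rw [hset] at hcheb
  rw [le_div_iff₀ (by positivity)]
  have h3 := hcheb.trans hV
  have h4 : (0 : ℝ) < n ^ 2 := by positivity
  have h5 : (n : ℝ) ^ 2 / Real.log n ^ 2 * Real.log n ^ 2 = n ^ 2 := by field_simp
  have h6 := mul_le_mul_of_nonneg_right h3 (sq_nonneg (Real.log n))
  refine le_of_mul_le_mul_left ?_ h4
  calc _ = (n * δ) ^ 2 * μ.real {x | n * δ ≤ |birkhoffSum T φ n x - n * m|} * Real.log n ^ 2 := by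
        ring
    _ ≤ 2 * ((16 * (M + |m|) ^ 2 + 4 * c) * (n ^ 2 / Real.log n ^ 2)) * Real.log n ^ 2 := h6
    _ = _ := by linear_combination 2 * (16 * (M + |m|) ^ 2 + 4 * c) * h5

end Ergodic

/-! ### Sampling times and effective summability -/

section SamplingTimes

/-- A slowly growing unbounded function, of the order of the eighth root. -/
def slowRoot (i : ℕ) : ℕ := 1 + i.sqrt.sqrt.sqrt

/-- Sampling times growing subexponentially, with consecutive ratios tending to one. -/
def samplingTime : ℕ → ℕ
  | 0 => 2
  | i + 1 => samplingTime i + samplingTime i / slowRoot i + 1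

theorem slowRoot_computable : Computable slowRoot :=
  (Primrec.succ.comp (Primrec.nat_sqrt.comp (Primrec.nat_sqrt.comp Primrec.nat_sqrt))).to_comp.of_eq
    fun _ => (Nat.add_comm 1 _).symm

theorem samplingTime_computable : Computable samplingTime := by
  have h : Computable fun i : ℕ => (i.rec 2 fun k IH => IH + IH / slowRoot k + 1 : ℕ) := by
    refine Computable.nat_rec (f := fun i : ℕ => i) (g := fun _ => 2)
      (h := fun _ x => x.2 + x.2 / slowRoot x.1 + 1) Computable.id (Computable.const 2) ?_
    have c2 : Computable fun y : ℕ × (ℕ × ℕ) => y.2.2 := Computable.snd.comp Computable.snd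
    exact (Computable.succ.comp (c2.add (Primrec.nat_div.to_comp.comp c2
      (slowRoot_computable.comp (Computable.fst.comp Computable.snd))))).to₂
  refine h.of_eq fun i => ?_
  induction i with
  | zero => rfl
  | succ k ih => simp only [samplingTime, ← ih]

theorem slowRoot_mono : Monotone slowRoot := fun _ _ h =>
  Nat.add_le_add_left (Nat.sqrt_le_sqrt (Nat.sqrt_le_sqrt (Nat.sqrt_le_sqrt h))) 1

theorem slowRoot_pos (i : ℕ) : 0 < slowRoot i := Nat.add_pos_left one_pos _

theorem slowRoot_tendsto : Tendsto slowRoot atTop atTop := by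
  refine tendsto_atTop_mono' atTop (f₁ := fun i : ℕ => i.sqrt.sqrt.sqrt)
    (Eventually.of_forall fun i => Nat.le_add_left _ _) ?_
  have h : Tendsto Nat.sqrt atTop atTop :=
    tendsto_atTop_atTop.2 fun b => ⟨b * b, fun a ha => Nat.le_sqrt.2 ha⟩
  exact h.comp (h.comp h)

/-- Two powers of `slowRoot` arise from `δ⁻²` and two from `(log samplingTime)⁻²`. An eighth root
keeps their product of order `√i`, leaving the summable rate `i^(-3/2)`. -/
theorem slowRoot_pow_four_le {i : ℕ} (hi : 1 ≤ i) : (slowRoot i : ℝ) ^ 4 ≤ 16 * √(i : ℝ) := by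
  have h1 : 1 ≤ i.sqrt := Nat.le_sqrt.2 (by omega)
  have h2 : 1 ≤ i.sqrt.sqrt := Nat.le_sqrt.2 (by omega)
  have h3 : 1 ≤ i.sqrt.sqrt.sqrt := Nat.le_sqrt.2 (by omega)
  have e1 : slowRoot i ≤ 2 * i.sqrt.sqrt.sqrt := by unfold slowRoot; omega
  have e2 : (i.sqrt.sqrt.sqrt) ^ 4 ≤ i.sqrt := by
    calc (i.sqrt.sqrt.sqrt) ^ 4 = (i.sqrt.sqrt.sqrt ^ 2) ^ 2 := by ring
      _ ≤ (i.sqrt.sqrt) ^ 2 := Nat.pow_le_pow_left (Nat.sqrt_le' _) 2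
      _ ≤ i.sqrt := Nat.sqrt_le' _
  have e3 : slowRoot i ^ 4 ≤ 16 * i.sqrt := by
    calc slowRoot i ^ 4 ≤ (2 * i.sqrt.sqrt.sqrt) ^ 4 := Nat.pow_le_pow_left e1 4
      _ = 16 * (i.sqrt.sqrt.sqrt) ^ 4 := by ring
      _ ≤ 16 * i.sqrt := Nat.mul_le_mul_left 16 e2
  calc (slowRoot i : ℝ) ^ 4 ≤ 16 * (i.sqrt : ℝ) := by exact_mod_cast e3
    _ ≤ 16 * √(i : ℝ) := by gcongr; exact Real.nat_sqrt_le_real_sqrt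

theorem two_le_samplingTime (i : ℕ) : 2 ≤ samplingTime i := by
  induction i with
  | zero => exact le_rfl
  | succ k ih =>
    have := Nat.zero_le (samplingTime k / slowRoot k)
    simp only [samplingTime]
    omega

theorem samplingTime_pos (i : ℕ) : 0 < samplingTime i :=
  two_pos.trans_le (two_le_samplingTime i)

theorem le_samplingTime (i : ℕ) : i ≤ samplingTime i := by
  induction i with
  | zero => exact Nat.zero_le _
  | succ k ih =>
    have := Nat.zero_le (samplingTime k / slowRoot k)
    simp only [samplingTime]
    omega

theorem samplingTime_tendsto : Tendsto samplingTime atTop atTop :=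
  tendsto_atTop_mono le_samplingTime tendsto_id

/-- Each step multiplies the time by at least `1 + 1 / slowRoot k`, the final `+ 1` of the recursion
making up for the floor. The logarithm grows by at least `1 / (2 * slowRoot k)`, and `slowRoot` is
monotone. -/
theorem le_log_samplingTime (i : ℕ) :
    (i : ℝ) / (2 * slowRoot i) ≤ Real.log (samplingTime i) := by
  induction i with
  | zero => simpa using Real.log_nonneg (by norm_num [samplingTime])
  | succ k ih =>
    have hs : (0 : ℝ) < samplingTime k := by exact_mod_cast samplingTime_pos k
    have hh : (1 : ℝ) ≤ slowRoot k := by exact_mod_cast slowRoot_pos k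
    have h1 : (samplingTime k : ℝ) * (1 + 1 / slowRoot k) ≤ samplingTime (k + 1) := by
      have h2 : (samplingTime k : ℝ) / slowRoot k < (samplingTime k / slowRoot k : ℕ) + 1 := by
        rw [div_lt_iff₀ (by linarith)]
        have := Nat.lt_div_mul_add (a := samplingTime k) (slowRoot_pos k)
        have h4 : samplingTime k < (samplingTime k / slowRoot k + 1) * slowRoot k := by
          rw [add_mul, one_mul]
          exact this
        exact_mod_cast h4
      simp only [samplingTime]
      push_cast
      rw [mul_add, mul_one, mul_one_div]
      linarith
    have h2 : 1 / (2 * (slowRoot k : ℝ)) ≤ Real.log (1 + 1 / slowRoot k) := by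
      have h3 := Real.one_sub_inv_le_log_of_pos (by positivity : (0 : ℝ) < 1 + 1 / slowRoot k)
      refine le_trans ?_ h3
      have h4 : 1 - (1 + 1 / (slowRoot k : ℝ))⁻¹ = 1 / (slowRoot k + 1) := by
        field_simp
        ring
      rw [h4]
      exact one_div_le_one_div_of_le (by linarith) (by linarith)
    have hm : (slowRoot k : ℝ) ≤ slowRoot (k + 1) := by exact_mod_cast slowRoot_mono k.le_succ
    calc ((k + 1 : ℕ) : ℝ) / (2 * slowRoot (k + 1)) ≤ ((k + 1 : ℕ) : ℝ) / (2 * slowRoot k) := by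
          gcongr
      _ = k / (2 * slowRoot k) + 1 / (2 * slowRoot k) := by push_cast; ring
      _ ≤ Real.log (samplingTime k) + Real.log (1 + 1 / slowRoot k) := add_le_add ih h2
      _ = Real.log (samplingTime k * (1 + 1 / slowRoot k)) :=
          (Real.log_mul hs.ne' (by positivity)).symm
      _ ≤ Real.log (samplingTime (k + 1)) := Real.log_le_log (by positivity) h1

theorem eventually_samplingTime_succ_le {a : ℝ} (ha : 1 < a) :
    ∀ᶠ i in atTop, (samplingTime (i + 1) : ℝ) ≤ a * samplingTime i := by
  have h1 : Tendsto (fun i => (1 : ℝ) / slowRoot i + 1 / samplingTime i) atTop (𝓝 0) := by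
    have e1 : Tendsto (fun i => (1 : ℝ) / slowRoot i) atTop (𝓝 0) :=
      tendsto_const_nhds.div_atTop (tendsto_natCast_atTop_atTop.comp slowRoot_tendsto)
    have e2 : Tendsto (fun i => (1 : ℝ) / samplingTime i) atTop (𝓝 0) :=
      tendsto_const_nhds.div_atTop (tendsto_natCast_atTop_atTop.comp samplingTime_tendsto)
    simpa using e1.add e2
  filter_upwards [h1.eventually_lt_const (sub_pos.2 ha)] with i hi
  have hs : (0 : ℝ) < samplingTime i := by exact_mod_cast samplingTime_pos i
  have h2 : ((samplingTime i / slowRoot i : ℕ) : ℝ) ≤ samplingTime i / slowRoot i := Nat.cast_div_le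
  have h3 := mul_lt_mul_of_pos_left hi hs
  have h4 : (samplingTime i : ℝ) * (1 / slowRoot i + 1 / samplingTime i) =
      samplingTime i / slowRoot i + 1 := by
    field_simp
  simp only [samplingTime]
  push_cast
  linarith

/-- Convergence of Birkhoff averages along the sampling times implies convergence. -/
theorem tendsto_birkhoffAverage_of_samplingTime {X : Type*} {T : X → X} {φ : X → ℝ} {M : ℝ}
    (hM : ∀ x, |φ x| ≤ M) {x : X} {m : ℝ} {J : ℕ}
    (h : Tendsto (fun i => birkhoffSum T φ (samplingTime (i + J)) x / samplingTime (i + J)) atTop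
      (𝓝 m)) :
    Tendsto (fun n : ℕ => birkhoffAverage ℝ T φ n x) atTop (𝓝 m) := by
  have hs : ∀ i, (samplingTime i : ℝ) ≠ 0 := fun i => by
    exact_mod_cast (samplingTime_pos i).ne'
  -- Adding `M * n` makes the Birkhoff sums monotone in `n`, so they can be interpolated between
  -- sampling times whose ratios tend to one.
  have key := tendsto_div_of_monotone_of_exists_subseq_tendsto_div
    (fun n => birkhoffSum T φ n x + M * n) (m + M)
    (monotone_nat_of_le_succ fun n => by
      rw [birkhoffSum_succ]
      push_cast
      linarith [(abs_le.1 (hM (T^[n] x))).1])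
    (fun a ha => ⟨fun i => samplingTime (i + J), by
      have := (tendsto_add_atTop_nat J).eventually (eventually_samplingTime_succ_le ha)
      simpa only [add_right_comm] using this,
      samplingTime_tendsto.comp (tendsto_add_atTop_nat J), by
      refine (h.add_const M).congr fun i => ?_
      rw [add_div, mul_div_cancel_right₀ _ (hs _)]⟩)
  have h2 : Tendsto (fun n : ℕ => (birkhoffSum T φ n x + M * n) / n - M) atTop (𝓝 m) := by
    simpa using key.sub_const M
  refine h2.congr' ?_
  filter_upwards [eventually_gt_atTop 0] with n hn
  have hn' : (n : ℝ) ≠ 0 := by exact_mod_cast hn.ne'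
  rw [birkhoffAverage, smul_eq_mul]
  field_simp
  ring

/-- Telescoping majorant for the exponent `3 / 2`, giving the tail from `N` the explicit bound `4 /
√(N + 1)`. -/
theorem one_div_mul_sqrt_le (i : ℕ) :
    1 / (((i : ℝ) + 1) * √((i : ℝ) + 1)) ≤ 4 * (1 / √((i : ℝ) + 1)) - 4 * (1 / √((i : ℝ) + 2)) := by
  set a := √((i : ℝ) + 1)
  set b := √((i : ℝ) + 2)
  have ha : 0 < a := Real.sqrt_pos.2 (by positivity)
  have hb : 0 < b := Real.sqrt_pos.2 (by positivity)
  have ha2 : a ^ 2 = (i : ℝ) + 1 := Real.sq_sqrt (by positivity)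
  have hb2 : b ^ 2 = (i : ℝ) + 2 := Real.sq_sqrt (by positivity)
  have hb3 : b ≤ 3 / 2 * a := by
    refine abs_le_of_sq_le_sq' ?_ (by positivity) |>.2
    rw [mul_pow, ha2, hb2]
    have : (0 : ℝ) ≤ i := Nat.cast_nonneg i
    linarith
  have e1 : 4 * (1 / a) - 4 * (1 / b) = 4 / (a * b * (a + b)) := by
    have : (b - a) * (a + b) = 1 := by linear_combination hb2 - ha2
    field_simp
    linarith
  rw [← ha2, e1, div_le_div_iff₀ (by positivity) (by positivity)]
  have h1 : b * (a + b) ≤ 15 / 4 * a ^ 2 := by nlinarith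
  nlinarith

theorem EffectivelySummable.of_le {a : ℕ → ℝ} {B : ℕ} (h0 : ∀ i, 0 ≤ a i)
    (h : ∀ i, a i ≤ B * (1 / (((i : ℝ) + 1) * √((i : ℝ) + 1)))) : EffectivelySummable a := by
  set s : ℕ → ℝ := fun i => 4 * B * (1 / √((i : ℝ) + 1)) with hs
  have hstep : ∀ i, a i ≤ s i - s (i + 1) := by
    intro i
    refine (h i).trans ((mul_le_mul_of_nonneg_left (one_div_mul_sqrt_le i)
      (Nat.cast_nonneg B)).trans (le_of_eq ?_))
    simp only [hs]
    push_cast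
    rw [show (i : ℝ) + 1 + 1 = i + 2 by ring]
    ring
  have hs0 : ∀ i, 0 ≤ s i := fun i => by positivity
  have hpart : ∀ N n, ∑ i ∈ Finset.range n, a (N + i) ≤ s N := by
    intro N n
    have h1 : ∑ i ∈ Finset.range n, a (N + i) ≤ s N - s (N + n) := by
      induction n with
      | zero => simp
      | succ n ih =>
        rw [Finset.sum_range_succ]
        have := hstep (N + n)
        rw [← add_assoc]
        linarith
    linarith [hs0 (N + n)]
  refine ⟨h0, summable_of_sum_range_le h0 fun n => by simpa using hpart 0 n,
    -- If `d = k.unpair.2 + 1` is the denominator of the tolerance, the latter is at least `1 / d`,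
    -- and the tail bound `4 * B / √(N + 1)` is below `1 / d` for `N = (4 * B * d) ^ 2`.
    fun k => (4 * B * (k.unpair.2 + 1)) * (4 * B * (k.unpair.2 + 1)), ?_, fun k => ?_⟩
  · have : Computable fun k : ℕ => 4 * B * (k.unpair.2 + 1) :=
      (Computable.const (4 * B)).mul (Computable.succ.comp Computable.id.unpair₂)
    exact this.mul this
  · refine (Real.tsum_le_of_sum_range_le (fun i => h0 _) (hpart _)).trans ?_
    have h1 : (1 : ℝ) / (k.unpair.2 + 1) ≤ posRatOf k := by
      unfold posRatOf
      push_cast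
      gcongr
      linarith [(Nat.cast_nonneg k.unpair.1 : (0 : ℝ) ≤ k.unpair.1)]
    refine le_trans ?_ h1
    simp only [hs]
    push_cast
    set d : ℝ := (k.unpair.2 : ℝ) + 1
    have hd : 0 < d := by positivity
    set t : ℝ := 4 * B * d
    have ht : 0 ≤ t := by positivity
    have h2 : t ≤ √(t * t + 1) := Real.le_sqrt_of_sq_le (by nlinarith)
    have h3 : 0 < √(t * t + 1) := Real.sqrt_pos.2 (by positivity)
    rw [mul_one_div, div_le_div_iff₀ h3 hd]
    linarith

end SamplingTimes

/-! ### Computable points in Borel–Cantelli sets -/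

section ComputablePoint

variable {X : Type*} [MetricSpace X] [ComputableMetricSpace X]

/-- In a complete space, nested formally included ideal balls with fast shrinking radii meet in a
computable point. -/
theorem exists_computablePoint_of_nested [CompleteSpace X] {a : ℕ → ℕ} (ha : Computable a)
    (hincl : ∀ j, FormalIncl X (a (j + 1)) (a j))
    (hrad : ∀ j, (ballRadius (a j) : ℝ) ≤ (1 / 2) ^ j) :
    ∃ x : X, IsComputablePoint x ∧ ∀ j, x ∈ idealBall X (a j) := by
  have hr : ∀ k, (0 : ℝ) < ballRadius k := fun k => by exact_mod_cast posRatOf_pos _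
  have hstep : ∀ j, dist (ballCenter X (a (j + 1))) (ballCenter X (a j)) <
      (ballRadius (a j) : ℝ) - ballRadius (a (j + 1)) := fun j => by
    have := hincl j
    unfold FormalIncl at this
    push_cast at this
    exact this
  have hcauchy : CauchySeq fun j => ballCenter X (a j) := by
    refine cauchySeq_of_le_geometric (1 / 2) 1 (by norm_num) fun j => ?_
    rw [dist_comm, one_mul]
    linarith [hstep j, hr (a (j + 1)), hrad j]
  obtain ⟨x, hx⟩ := cauchySeq_tendsto_of_complete hcauchy
  have h1 : ∀ j i, dist (ballCenter X (a (j + i))) (ballCenter X (a j)) ≤ ballRadius (a j) -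
      ballRadius (a (j + i)) := by
    intro j i
    induction i with
    | zero => simp
    | succ i ih =>
      have := dist_triangle (ballCenter X (a (j + i + 1))) (ballCenter X (a (j + i)))
        (ballCenter X (a j))
      have := hstep (j + i)
      rw [← add_assoc]
      linarith
  have h2 : ∀ j, dist x (ballCenter X (a j)) ≤ ballRadius (a j) := by
    intro j
    have h3 : Tendsto (fun i => dist (ballCenter X (a (i + j))) (ballCenter X (a j))) atTop
        (𝓝 (dist x (ballCenter X (a j)))) :=
      ((tendsto_add_atTop_iff_nat j).2 hx).dist tendsto_const_nhds
    refine le_of_tendsto' h3 fun i => ?_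
    rw [add_comm]
    linarith [h1 j i, hr (a (j + i))]
  refine ⟨x, ⟨fun j => (a j).unpair.1, ha.unpair₁, fun j => ?_⟩, fun j => ?_⟩
  · rw [dist_comm]
    exact (h2 j).trans (hrad j)
  -- The limit is only known to lie in closed balls; the strict formal inclusion of the next ball
  -- puts it in the open one.
  · rw [mem_idealBall]
    have := dist_triangle x (ballCenter X (a (j + 1))) (ballCenter X (a j))
    linarith [h2 (j + 1), hstep j]

variable [MeasurableSpace X]

/-- The admissible balls form a countable cover of `S`, so they cannot all meet it in null sets. -/
theorem exists_idealBall_inter_pos {μ : Measure X} [IsFiniteMeasure μ] {S : Set X}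
    (hS : 0 < μ.real S) {q : ℕ → Prop} (hq : ∀ x ∈ S, ∃ k, q k ∧ x ∈ idealBall X k) :
    ∃ k, q k ∧ 0 < μ.real (idealBall X k ∩ S) := by
  by_contra! h
  have h1 : μ (⋃ (k : ℕ) (_ : q k), idealBall X k ∩ S) = 0 := by
    refine measure_iUnion_null fun k => measure_iUnion_null fun hk => ?_
    have := le_antisymm (h k hk) measureReal_nonneg
    exact (measureReal_eq_zero_iff (measure_ne_top _ _)).1 this
  have h2 : μ S = 0 := by
    refine measure_mono_null (fun x hx => ?_) h1
    obtain ⟨k, hk, hxk⟩ := hq x hx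
    exact Set.mem_iUnion₂.2 ⟨k, hk, hxk, hx⟩
  rw [measureReal_def, h2] at hS
  simp at hS

theorem measureReal_le_inter_add_tsum {Ω : Type*} [MeasurableSpace Ω] {μ : Measure Ω}
    [IsFiniteMeasure μ] {U : ℕ → Set Ω}
    (hU : Summable fun n => μ.real (U n)ᶜ) (A : Set Ω) :
    μ.real A ≤ μ.real (A ∩ {x | ∀ n, x ∈ U n}) + ∑' n, μ.real (U n)ᶜ := by
  have h1 : A ⊆ (A ∩ {x | ∀ n, x ∈ U n}) ∪ ⋃ n, (U n)ᶜ := by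
    intro x hx
    by_cases h : ∀ n, x ∈ U n
    · exact Or.inl ⟨hx, h⟩
    · push Not at h
      exact Or.inr (Set.mem_iUnion.2 h)
  have h2 : μ.real (⋃ n, (U n)ᶜ) ≤ ∑' n, μ.real (U n)ᶜ := by
    have h3 : (∑' n, μ (U n)ᶜ) = ENNReal.ofReal (∑' n, μ.real (U n)ᶜ) := by
      rw [ENNReal.ofReal_tsum_of_nonneg (fun n => measureReal_nonneg) hU]
      exact tsum_congr fun n => (ofReal_measureReal (measure_ne_top _ _)).symm
    rw [measureReal_def]
    refine ENNReal.toReal_le_of_le_ofReal (tsum_nonneg fun n => measureReal_nonneg) ?_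
    rw [← h3]
    exact measure_iUnion_le _
  exact (measureReal_mono h1).trans ((measureReal_union_le _ _).trans (by linarith))

/-- A constructive Borel–Cantelli set in a complete computable probability space contains
computable points. -/
theorem IsConstructiveBorelCantelli.exists_computablePoint [BorelSpace X] [CompleteSpace X]
    {μ : Measure X} [IsProbabilityMeasure μ] (hμ : IsComputableMeasure μ) {R : Set X}
    (hR : IsConstructiveBorelCantelli μ R) : ∃ x, IsComputablePoint x ∧ x ∈ R := by
  obtain ⟨U, hU, ⟨h0, hsum, N, hN, htail⟩, rfl⟩ := hR
  rw [uniformlyConstructiveOpen_iff] at hU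
  obtain ⟨p, hp, hUp⟩ := id hU
  obtain ⟨e₀, he₀⟩ := exists_posRatOf_eq (q := 1 / 2) (by norm_num)
  -- From `K` on, the exceptional sets have total measure at most `1 / 2`, so `S` has positive
  -- measure.
  set K := N e₀ with hK
  set S : Set X := {x | ∀ i, x ∈ U (K + i)} with hS
  have hshift : ∀ k, Summable fun i => μ.real (U (k + i))ᶜ := fun k => by
    simpa only [add_comm] using (summable_nat_add_iff k).2 hsum
  have hSpos : 0 < μ.real S := by
    have h1 := measureReal_le_inter_add_tsum (hshift K) Set.univ
    have h2 := htail e₀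
    rw [he₀] at h2
    push_cast at h2
    rw [Set.univ_inter, probReal_univ] at h1
    change 1 ≤ μ.real S + _ at h1
    linarith
  -- Semidecidable form of positivity of `μ (idealBall X v ∩ S)`: after the first `N e` constraints,
  -- the remaining ones remove at most `posRatOf e`.
  let P : ℕ → Prop := fun v =>
    ∃ e, (posRatOf e : ℝ) < μ.real (idealBall X v ∩ {x | ∀ i < N e, x ∈ U (K + i)})
  have hP : ∀ v, P v ↔ 0 < μ.real (idealBall X v ∩ S) := by
    intro v
    constructor
    · rintro ⟨e, he⟩
      have h1 := measureReal_le_inter_add_tsum (hshift (K + N e))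
        (idealBall X v ∩ {x | ∀ i < N e, x ∈ U (K + i)})
      have h2 : ∑' i, μ.real (U (K + N e + i))ᶜ ≤ posRatOf e := by
        refine le_trans ?_ (htail e)
        have h3 := (hshift (N e)).sum_add_tsum_nat_add K
        have h4 : ∀ i, μ.real (U (K + N e + i))ᶜ = μ.real (U (N e + (i + K)))ᶜ := fun i => by
          rw [show K + N e + i = N e + (i + K) by ring]
        rw [tsum_congr h4, ← h3]
        exact le_add_of_nonneg_left (Finset.sum_nonneg fun i _ => h0 _)
      have h5 : (idealBall X v ∩ {x | ∀ i < N e, x ∈ U (K + i)}) ∩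
          {x | ∀ n, x ∈ U (K + N e + n)} ⊆ idealBall X v ∩ S := by
        rintro x ⟨⟨hx1, hx2⟩, hx3⟩
        refine ⟨hx1, fun i => ?_⟩
        rcases lt_or_ge i (N e) with hi | hi
        · exact hx2 i hi
        · have := hx3 (i - N e)
          rwa [add_assoc, Nat.add_sub_cancel' hi] at this
      have h6 := measureReal_mono (μ := μ) h5
      linarith
    · intro h
      obtain ⟨q, hq0, hq⟩ := exists_rat_btwn h
      obtain ⟨e, he⟩ := exists_posRatOf_eq (q := q) (by exact_mod_cast hq0)
      refine ⟨e, ?_⟩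
      rw [he]
      exact hq.trans_le (measureReal_mono
        (Set.inter_subset_inter_right _ fun x hx i _ => hx i))
  have hPre : REPred P := by
    refine REPred.ex (p := fun v e => (posRatOf e : ℝ) <
      μ.real (idealBall X v ∩ {x | ∀ i < N e, x ∈ U (K + i)})) ?_
    refine hμ.re_lt_measureReal (U := fun y : ℕ × ℕ =>
      idealBall X y.1 ∩ {x | ∀ i < N y.2, x ∈ U (K + i)}) ?_ (RatComputable.posRatOf Computable.snd)
    refine ConstructiveOpen.inter (ConstructiveOpen.idealBall Computable.fst)
      (ConstructiveOpen.iInter_lt (U := fun (_ : ℕ × ℕ) i => U (K + i)) ?_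
        (hN.comp Computable.snd))
    exact hU.comp ((Computable.const K).add Computable.snd)
  -- The next ball shrinks inside the previous one, enters `U (K + j)`, and keeps `P` so that the
  -- search can continue.
  let r : ℕ → ℕ → ℕ → Prop := fun j v v' => (FormalIncl X v' v ∧
    ballRadius v' < (1 / 2) ^ (j + 1)) ∧ (∃ l, p (K + j) l ∧ FormalIncl X v' l) ∧ P v'
  have hr : REPred fun x : (ℕ × ℕ) × ℕ => r x.1.1 x.1.2 x.2 := by
    have cj : Computable fun x : (ℕ × ℕ) × ℕ => x.1.1 := Computable.fst.comp Computable.fst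
    refine REPred.and (REPred.and (re_formalIncl Computable.snd
      (Computable.snd.comp Computable.fst)) (RatComputable.re_lt
      (RatComputable.ballRadius Computable.snd) (RatComputable.pow (Computable.succ.comp cj))))
      (REPred.and (REPred.ex (p := fun (x : (ℕ × ℕ) × ℕ) l => p (K + x.1.1) l ∧
        FormalIncl X x.2 l) ?_) (hPre.comp Computable.snd))
    exact REPred.and (hp.comp (f := fun y : ((ℕ × ℕ) × ℕ) × ℕ => (K + y.1.1.1, y.2))
      (((Computable.const K).add (cj.comp Computable.fst)).pair Computable.snd))
      (re_formalIncl (Computable.snd.comp Computable.fst) Computable.snd)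
  obtain ⟨v₀, hv₀, hPv₀⟩ := exists_idealBall_inter_pos hSpos
    (q := fun k => (ballRadius k : ℝ) < 1) fun x _ => by
      obtain ⟨k, hk, -, hk'⟩ := exists_idealBall_formalIncl x ∅ (by simp) one_pos
      exact ⟨k, hk', hk⟩
  have hstep : ∀ j v, P v → ∃ v', r j v v' := by
    intro j v hv
    obtain ⟨k, ⟨hk1, hk2⟩, hk3⟩ := exists_idealBall_inter_pos ((hP v).1 hv)
      (q := fun v' => (FormalIncl X v' v ∧ ballRadius v' < (1 / 2) ^ (j + 1)) ∧
        ∃ l, p (K + j) l ∧ FormalIncl X v' l) (by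
      rintro x ⟨hxv, hxS⟩
      obtain ⟨l, hl, hxl⟩ := (hUp (K + j) x).1 (hxS j)
      obtain ⟨k, hk, hF, hkr⟩ := exists_idealBall_formalIncl x {v, l} (by simp [hxv, hxl])
        (ε := (1 / 2) ^ (j + 1)) (by positivity)
      refine ⟨k, ⟨⟨hF v (by simp), (Rat.cast_lt (K := ℝ)).1 ?_⟩, l, hl, hF l (by simp)⟩, hk⟩
      push_cast
      exact hkr)
    refine ⟨k, hk1, hk2, (hP k).2 (hk3.trans_le (measureReal_mono ?_))⟩
    exact Set.inter_subset_inter_right _ Set.inter_subset_right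
  obtain ⟨a, ha, ha0, har⟩ := hr.exists_computable_chain ((hP v₀).2 hPv₀) hstep
    fun _ _ _ h => h.2.2
  obtain ⟨x, hx, hxa⟩ := exists_computablePoint_of_nested (X := X) ha (fun j => (har j).1.1) (by
    intro j
    cases j with
    | zero => rw [ha0, pow_zero]; exact hv₀.le
    | succ j =>
      have := (Rat.cast_lt (K := ℝ)).2 (har j).1.2
      push_cast at this
      exact this.le)
  refine ⟨x, hx, Set.mem_iUnion.2 ⟨K, Set.mem_iInter₂.2 fun n hn => ?_⟩⟩
  obtain ⟨l, hl, hF⟩ := (har (n - K)).2.1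
  rw [Nat.add_sub_cancel' hn] at hl
  exact (hUp n x).2 ⟨l, hl, hF.subset (hxa _)⟩

end ComputablePoint

/-! ### Construction of the Borel–Cantelli set and conclusion -/

section Main

variable {X : Type*} [MetricSpace X] [ComputableMetricSpace X]

theorem IsComputableOn.mono {Y : Type*} [MetricSpace Y] [ComputableMetricSpace Y] {f : X → Y}
    {D E : Set X} (hf : IsComputableOn f E) (h : D ⊆ E) : IsComputableOn f D := by
  obtain ⟨U, hU, hfU⟩ := hf
  refine ⟨U, hU, fun i => ?_⟩
  rw [← Set.inter_eq_self_of_subset_right h, ← Set.inter_assoc, ← Set.inter_assoc, hfU]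

variable [MeasurableSpace X] [BorelSpace X]

theorem IsConstructiveGδ.measurableSet {D : Set X} (hD : IsConstructiveGδ D) :
    MeasurableSet D := by
  obtain ⟨U, hU, rfl⟩ := hD
  exact MeasurableSet.iInter fun n => ((uniformlyConstructiveOpen_iff.1 hU).isOpen n).measurableSet

/-- A measure-preserving map and an observable that are both almost everywhere computable admit a
common full-measure constructive `G_δ`-set on which all values along orbits are computable. -/
theorem exists_orbit_domain {μ : Measure X} [IsProbabilityMeasure μ] {T : X → X}
    (hT : MeasurePreserving T μ μ) (hTc : IsDeltaAEComputable μ T) {φ : X → ℝ}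
    (hφc : IsDeltaAEComputable μ φ) :
    ∃ D : Set X, IsConstructiveGδ D ∧ D ∈ ae μ ∧ ∃ V : ℕ × ℕ → Set X, ConstructiveOpen V ∧
      ∀ j i, ∀ x ∈ D, x ∈ V (j, i) ↔ φ (T^[j] x) ∈ idealBall ℝ i := by
  obtain ⟨D₁, hD₁, hD₁1, hT₁⟩ := hTc
  obtain ⟨D₂, hD₂, hD₂1, F, hF, hφF⟩ := hφc
  obtain ⟨D, hD, hDsub, hinv, hcore, hpull⟩ :=
    IsComputableOn.exists_invariant_core (hD₁.inter hD₂) (hT₁.mono Set.inter_subset_left)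
  obtain ⟨V, hV, hVF⟩ := hpull F (uniformlyConstructiveOpen_iff.1 hF)
  have hae : D₁ ∩ D₂ ∈ ae μ := inter_mem ((mem_ae_iff_prob_eq_one hD₁.measurableSet).2 hD₁1)
    ((mem_ae_iff_prob_eq_one hD₂.measurableSet).2 hD₂1)
  have horb : ∀ j, ∀ x ∈ D, T^[j] x ∈ D := by
    intro j
    induction j with
    | zero => exact fun x hx => hx
    | succ j ih => exact fun x hx => ih _ (hinv x hx)
  refine ⟨D, hD, mem_of_superset (countable_iInter_mem.2 fun j =>
    (hT.iterate j).quasiMeasurePreserving.tendsto_ae hae) hcore, V, hV, fun j i x hx => ?_⟩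
  have h1 := Set.ext_iff.1 (hφF i) (T^[j] x)
  have h2 : T^[j] x ∈ D₂ := (hDsub (horb j x hx)).2
  simp only [Set.mem_inter_iff, Set.mem_preimage, h2, and_true] at h1
  rw [hVF j i x hx, h1]

/-- The deviation probabilities along the sampling times are dominated by a summable series. -/
theorem deviation_samplingTime_le {C : ℝ} (hC : 0 ≤ C) (i : ℕ) :
    C / ((1 / (slowRoot (i + 1) : ℝ)) ^ 2 * Real.log (samplingTime (i + 1)) ^ 2) ≤
      64 * C * (1 / (((i : ℝ) + 1) * √((i : ℝ) + 1))) := by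
  have h1 := le_log_samplingTime (i + 1)
  have h2 := slowRoot_pow_four_le (Nat.le_add_left 1 i)
  have hs : (0 : ℝ) < slowRoot (i + 1) := by exact_mod_cast slowRoot_pos _
  push_cast at h1 h2
  set s : ℝ := (slowRoot (i + 1) : ℝ)
  set t : ℝ := (i : ℝ) + 1
  have ht : 0 < t := by positivity
  have hq : 0 < √t := Real.sqrt_pos.2 ht
  have hqq : √t * √t = t := Real.mul_self_sqrt ht.le
  calc C / ((1 / s) ^ 2 * Real.log (samplingTime (i + 1)) ^ 2)
      ≤ C / ((1 / s) ^ 2 * (t / (2 * s)) ^ 2) := by gcongr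
    _ = 4 * C * s ^ 4 / t ^ 2 := by field_simp; norm_num
    _ ≤ 4 * C * (16 * √t) / t ^ 2 := by gcongr
    _ = 64 * C * (1 / (t * √t)) := by
      field_simp
      linear_combination 64 * C * hqq

/-- The Birkhoff averages of an almost everywhere computable observable with summable deviation
probabilities converge on a constructive Borel–Cantelli set. -/
theorem exists_borelCantelli_subset_typical {μ : Measure X} [IsProbabilityMeasure μ]
    (hμ : IsComputableMeasure μ) {T : X → X} (hT : MeasurePreserving T μ μ)
    (hTc : IsDeltaAEComputable μ T) {φ : X → ℝ} (hφc : IsDeltaAEComputable μ φ) {M : ℝ}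
    (hM : ∀ x, |φ x| ≤ M) {C : ℝ} (hC0 : 0 ≤ C)
    (hC : ∀ n : ℕ, 2 ≤ n → ∀ δ : ℝ, 0 < δ →
      μ.real {x | n * δ ≤ |birkhoffSum T φ n x - n * ∫ y, φ y ∂μ|} ≤
        C / (δ ^ 2 * Real.log n ^ 2)) :
    ∃ R : Set X, IsConstructiveBorelCantelli μ R ∧ R ⊆ {x | IsTypical T μ φ x} := by
  set m : ℝ := ∫ y, φ y ∂μ with hm
  obtain ⟨D, ⟨UD, hUD, rfl⟩, hDae, V, hV, hφV⟩ := exists_orbit_domain hT hTc hφc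
  obtain ⟨B, hB⟩ := exists_nat_ge (64 * C)
  -- Starting this late makes every deviation probability smaller than `1 / 2`, as the search for
  -- the `q i` needs.
  let J : ℕ := 2 * B + 1
  let n : ℕ → ℕ := fun i => samplingTime (i + 1 + J)
  let δ : ℕ → ℚ := fun i => 1 / (slowRoot (i + 1 + J) : ℚ)
  have hδ0 : ∀ i, (0 : ℝ) < δ i := fun i => by
    have : (0 : ℚ) < δ i := one_div_pos.2 (by exact_mod_cast slowRoot_pos _)
    exact_mod_cast this
  have hn0 : ∀ i, (0 : ℝ) < n i := fun i => by exact_mod_cast samplingTime_pos _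
  have hshift : Computable fun i : ℕ => i + 1 + J :=
    (Computable.id.add (Computable.const 1)).add (Computable.const J)
  have hn : Computable n := samplingTime_computable.comp hshift
  have hδ : RatComputable δ := by
    have h := RatComputable.inv_succ (Computable.pred.comp (slowRoot_computable.comp hshift))
    refine (funext fun i => ?_ : _ = δ) ▸ h
    have h1 := Nat.succ_pred_eq_of_pos (slowRoot_pos (i + 1 + J))
    have h2 : ((slowRoot (i + 1 + J)).pred : ℚ) + 1 = slowRoot (i + 1 + J) := by
      exact_mod_cast h1
    simp only [h2, δ]
  have hbad : ∀ i, μ.real {x | n i * (δ i : ℝ) ≤ |birkhoffSum T φ (n i) x - n i * m|} ≤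
      B * (1 / (((i + J : ℕ) + 1) * √(((i + J : ℕ) : ℝ) + 1))) := by
    intro i
    have e : i + 1 + J = i + J + 1 := by ring
    have h1 := hC (n i) (two_le_samplingTime _) (δ i) (hδ0 i)
    refine h1.trans ?_
    have h2 := deviation_samplingTime_le hC0 (i + J)
    simp only [n, δ, e]
    push_cast at h2 ⊢
    refine h2.trans ?_
    gcongr
  have hdec : ∀ i k : ℕ, i ≤ k → 1 / (((k : ℝ) + 1) * √((k : ℝ) + 1)) ≤
      1 / (((i : ℝ) + 1) * √((i : ℝ) + 1)) := by
    intro i k hik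
    gcongr
  have hhalf : ∀ i, μ.real {x | n i * (δ i : ℝ) ≤ |birkhoffSum T φ (n i) x - n i * m|} <
      1 / 2 := by
    intro i
    refine (hbad i).trans_lt ?_
    have h1 : (2 * B + 1 : ℝ) ≤ ((i + J : ℕ) : ℝ) := by
      have : 2 * B + 1 ≤ i + J := Nat.le_add_left _ _
      exact_mod_cast this
    set t : ℝ := ((i + J : ℕ) : ℝ)
    have hB0 : (0 : ℝ) ≤ B := Nat.cast_nonneg B
    have h2 : 1 ≤ √(t + 1) := Real.one_le_sqrt.2 (by linarith)
    rw [mul_one_div, div_lt_div_iff₀ (by nlinarith) two_pos]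
    nlinarith
  -- The open sets below are controlled only on the full-measure orbit domain, so they are compared
  -- with the deviation events almost everywhere.
  have hmeasure : ∀ W : Set X, ∀ i,
      (∀ x ∈ ⋂ k, UD k, |birkhoffSum T φ (n i) x - n i * m| < n i * (δ i : ℝ) → x ∈ W) →
      μ.real Wᶜ ≤ μ.real {x | n i * (δ i : ℝ) ≤ |birkhoffSum T φ (n i) x - n i * m|} := by
    intro W i hW
    refine ENNReal.toReal_mono (measure_ne_top _ _) (measure_mono_ae ?_)
    filter_upwards [hDae] with x hx hxW
    exact not_lt.1 fun hlt => hxW (hW x hx hlt)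
  obtain ⟨W₁, hW₁, hW₁D⟩ := exists_constructiveOpen_birkhoffSum hV hφV
    (n := fun y : ℕ × ℕ => n y.1) (q := fun y => ratOf y.2) (δ := fun y => 2 * δ y.1)
    (hn.comp Computable.fst) (RatComputable.ratOf Computable.snd)
    ((RatComputable.const 2).mul (hδ.comp Computable.fst))
  have hmeas₁ : ∀ y, MeasurableSet (W₁ y) := fun y => (hW₁.isOpen y).measurableSet
  -- Search for a rational stand-in for the integral. A rational within `δ i` of `m` qualifies,
  -- since the tolerance `2 * δ i` then covers every point whose deviation is below `δ i`.
  obtain ⟨q, hq, hqW⟩ := REPred.exists_computable_choice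
    (p := fun i e : ℕ => ((1 / 2 : ℚ) : ℝ) < μ.real (W₁ (i, e)))
    (hμ.re_lt_measureReal hW₁ (RatComputable.const (1 / 2))) (by
      intro i
      obtain ⟨r, hr1, hr2⟩ := exists_rat_btwn (show m < m + δ i by linarith [hδ0 i])
      obtain ⟨e, rfl⟩ := ratOf_surjective r
      refine ⟨e, ?_⟩
      have h1 := hmeasure (W₁ (i, e)) i fun x hx hlt => by
        refine (hW₁D (i, e) x hx).2 ?_
        push_cast
        have h2 : birkhoffSum T φ (n i) x - n i * (ratOf e : ℝ) =
          (birkhoffSum T φ (n i) x - n i * m) - n i * (ratOf e - m) := by ring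
        have h3 : |(n i : ℝ) * (ratOf e - m)| ≤ n i * δ i := by
          rw [abs_of_nonneg (mul_nonneg (hn0 i).le (by linarith))]
          exact mul_le_mul_of_nonneg_left (by linarith) (hn0 i).le
        rw [h2]
        refine (abs_sub _ _).trans_lt ?_
        linarith
      have h2 := hhalf i
      rw [probReal_compl_eq_one_sub (hmeas₁ _)] at h1
      push_cast
      linarith)
  have hqm : ∀ i, |(ratOf (q i) : ℝ) - m| < 3 * δ i := by
    intro i
    have h1 := hqW i
    push_cast at h1
    obtain ⟨x, hx, hxD, hxW⟩ : ∃ x, (x ∈ ⋂ k, UD k) ∧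
        -- An event of measure above `1 / 2` meets one whose complement has measure below `1 / 2`.
        -- At a common point the average is within `δ i` of `m` and `2 * δ i` of `q i`.
        |birkhoffSum T φ (n i) x - n i * m| < n i * (δ i : ℝ) ∧ x ∈ W₁ (i, q i) := by
      by_contra! hcon
      have h2 := hmeasure (W₁ (i, q i))ᶜ i fun x hx hlt => hcon x hx hlt
      rw [compl_compl] at h2
      linarith [hhalf i]
    have h3 := (hW₁D (i, q i) x hx).1 hxW
    push_cast at h3
    have h4 : (n i : ℝ) * |(ratOf (q i) : ℝ) - m| < n i * (3 * δ i) := by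
      rw [← abs_of_pos (hn0 i), ← abs_mul, abs_of_pos (hn0 i)]
      have h5 : (n i : ℝ) * (ratOf (q i) - m) = (birkhoffSum T φ (n i) x - n i * m) -
        (birkhoffSum T φ (n i) x - n i * ratOf (q i)) := by ring
      rw [h5]
      refine (abs_sub _ _).trans_lt ?_
      linarith
    exact lt_of_mul_lt_mul_left h4 (hn0 i).le
  -- The tolerance is `4 = 1 + 3`: the deviation from `m` plus the error of `q i`.
  obtain ⟨W₂, hW₂, hW₂D⟩ := exists_constructiveOpen_birkhoffSum hV hφV hn
    (RatComputable.ratOf hq) ((RatComputable.const 4).mul hδ)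
  -- A point in all `U i` from some index on lies in every `UD k`, hence in the orbit domain. The
  -- extra constraints cost no measure.
  let U : ℕ → Set X := fun i => W₂ i ∩ {x | ∀ k < i + 1, x ∈ UD k}
  have hU : ConstructiveOpen U := hW₂.inter (ConstructiveOpen.iInter_lt
    (U := fun (_ : ℕ) k => UD k) ((uniformlyConstructiveOpen_iff.1 hUD).comp Computable.snd)
    Computable.succ)
  have hUc : ∀ i, μ.real (U i)ᶜ ≤ B * (1 / (((i : ℝ) + 1) * √((i : ℝ) + 1))) := by
    intro i
    refine (hmeasure (U i) i fun x hx hlt => ?_).trans ((hbad i).trans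
      (mul_le_mul_of_nonneg_left (hdec i (i + J) (Nat.le_add_right _ _)) (Nat.cast_nonneg B)))
    refine ⟨(hW₂D i x hx).2 ?_, fun k _ => Set.mem_iInter.1 hx k⟩
    push_cast
    have h2 : birkhoffSum T φ (n i) x - n i * (ratOf (q i) : ℝ) =
      (birkhoffSum T φ (n i) x - n i * m) - n i * (ratOf (q i) - m) := by ring
    have h3 : |(n i : ℝ) * (ratOf (q i) - m)| ≤ n i * (3 * δ i) := by
      rw [abs_mul, abs_of_pos (hn0 i)]
      exact mul_le_mul_of_nonneg_left (hqm i).le (hn0 i).le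
    rw [h2]
    refine (abs_sub _ _).trans_lt ?_
    linarith
  refine ⟨_, ⟨U, uniformlyConstructiveOpen_iff.2 hU,
    EffectivelySummable.of_le (fun i => measureReal_nonneg) hUc, rfl⟩, fun x hx => ?_⟩
  obtain ⟨k, hk⟩ := Set.mem_iUnion.1 hx
  have hxU : ∀ i, k ≤ i → x ∈ U i := fun i hi => Set.mem_iInter₂.1 hk i hi
  have hxD : x ∈ ⋂ k, UD k := Set.mem_iInter.2 fun j =>
    (hxU (max k j) (le_max_left _ _)).2 j (Nat.lt_succ_of_le (le_max_right _ _))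
  -- Here `7 = 4 + 3`: the distance from the average to `q i`, plus that from `q i` to `m`.
  have hδ_lim : Tendsto (fun i => 7 * (δ i : ℝ)) atTop (𝓝 0) := by
    have e1 : Tendsto (fun i => (1 : ℝ) / slowRoot (i + (1 + J))) atTop (𝓝 0) :=
      (tendsto_add_atTop_iff_nat (f := fun i => (1 : ℝ) / slowRoot i) (1 + J)).2
        (tendsto_const_nhds.div_atTop (tendsto_natCast_atTop_atTop.comp slowRoot_tendsto))
    have e2 := e1.const_mul 7
    rw [mul_zero] at e2
    refine e2.congr fun i => ?_
    simp only [δ]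
    push_cast
    rw [add_assoc]
  refine tendsto_birkhoffAverage_of_samplingTime (J := 1 + J) hM ?_
  rw [tendsto_iff_dist_tendsto_zero]
  refine squeeze_zero' (Eventually.of_forall fun _ => dist_nonneg) ?_ hδ_lim
  filter_upwards [eventually_ge_atTop k] with i hi
  have h1 := (hW₂D i x hxD).1 (hxU i hi).1
  push_cast at h1
  rw [← add_assoc]
  change dist (birkhoffSum T φ (n i) x / n i) m ≤ _
  have h2 : birkhoffSum T φ (n i) x / n i - m =
      (birkhoffSum T φ (n i) x - n i * ratOf (q i)) / n i + (ratOf (q i) - m) := by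
    have := (hn0 i).ne'
    field_simp
    ring
  have h3 : |(birkhoffSum T φ (n i) x - n i * ratOf (q i)) / n i| < 4 * δ i := by
    rw [abs_div, abs_of_pos (hn0 i), div_lt_iff₀ (hn0 i)]
    linarith
  rw [Real.dist_eq, h2]
  refine (abs_add_le _ _).trans ?_
  linarith [hqm i]

end Main

theorem mainTheorem3 {X : Type*} [MetricSpace X] [ComputableMetricSpace X]
    [MeasurableSpace X] [BorelSpace X] (T : X → X) (μ : Measure X)
    (hT : IsComputableDynamicalSystem T μ)
    (𝓑 : Set (X → ℝ))
    (h𝓑 : ∀ ψ ∈ 𝓑, Measurable ψ ∧ ∃ M : ℝ, ∀ x, |ψ x| ≤ M)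
    (herg : IsLnSqErgodic T μ 𝓑)
    (φ : X → ℝ) (hφ : φ ∈ 𝓑) (hφc : IsDeltaAEComputable μ φ) :
    (∃ R : Set X, IsConstructiveBorelCantelli μ R ∧ R ⊆ {x | IsTypical T μ φ x}) ∧
      (CompleteSpace X → ∃ x : X, IsComputablePoint x ∧ IsTypical T μ φ x) := by
  have hprob := hT.isProbabilityMeasure
  obtain ⟨hφm, M, hM⟩ := h𝓑 φ hφ
  obtain ⟨c, hc, hcn⟩ := herg φ hφ φ hφ
  obtain ⟨C, hC0, hC⟩ := exists_deviation_bound hT.measurePreserving hφm hM hc hcn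
  obtain ⟨R, hR, hRφ⟩ := exists_borelCantelli_subset_typical hT.isComputableMeasure
    hT.measurePreserving hT.isDeltaAEComputable hφc hM hC0 hC
  refine ⟨⟨R, hR, hRφ⟩, fun _ => ?_⟩
  obtain ⟨x, hx, hxR⟩ := hR.exists_computablePoint hT.isComputableMeasure
  exact ⟨x, hx, hRφ hxR⟩
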